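/- Let $(\Omega,\mathscr B,\mathbf P)$ be a probability space, let $d\in\mathbf N$ and $p>0$, and let $u:\mathscr S(\mathbf R^d)\to L^2(\Omega)$ be a conjugate linear continuous operator, written $\varphi\mapsto(u,\varphi)$, with zero mean ($\mathbf E(u,\varphi)=0$ for all $\varphi$). Assume that - $u$ is Gaussian: for all $\varphi_1,\dots,\varphi_n\in\mathscr S(\mathbf R^d)$ the real and imaginary parts of $((u,\varphi_1),\dots,(u,\varphi_n))$ form a (possibly degenerate) real Gaussian vector; - $u$ is symmetric: for every $\lambda\in\mathbf C$ with $|\lambda|=1$ the processes $\lambda u$ and $u$ have the same finite dimensional probability laws; - $u$ is white noise with power $p$. Here a conjugate linear continuous $v:\mathscr S(\mathbf R^n)\to L^2(\Omega)$ is called white noise with power $q>0$ if it is stationary, that is, its mean is constant ($\mathbf E(v,\varphi)=c\int\overline{\varphi(x)}\,\mathrm dx$ for some $c\in\mathbf C$ and all $\varphi$) and $\mathbf E\big((v,\varphi)\overline{(v,\psi)}\big)$ is unchanged when $\varphi,\psi$ are both translated by the same vector, and if $$\mathbf E\big((v,\varphi)\overline{(v,\psi)}\big)=q\int_{\mathbf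 R^n}\psi(x)\overline{\varphi(x)}\,\mathrm dx\qquad\text{for all }\varphi,\psi\in\mathscr S(\mathbf R^n).$$ Then there is a unique conjugate linear continuous operator $U=u\otimes\overline u:\mathscr S(\mathbf R^{2d})\to L^2(\Omega)$ such that $(U,\varphi\otimes\overline\psi)=(u,\varphi)\overline{(u,\psi)}$ for all $\varphi,\psi\in\mathscr S(\mathbf R^d)$. For $\Phi\in\mathscr S(\mathbf R^{2d})$ put $$(A\Phi)(x,y)=(2\pi)^{-\frac d2}\int_{\mathbf R^d}\Phi\Big(\frac{x+y}2,\xi\Big)e^{i\langle x-y,\xi\rangle}\,\mathrm d\xi,\qquad x,y\in\mathbf R^d,$$ and define the Wigner distribution $W(u)$ and the zero mean Wigner distribution $W_0(u)$ of $u$, conjugate linear continuous operators $\mathscr S(\mathbf R^{2d})\to L^2(\Omega)$ on phase space $T^*\mathbf R^d=\mathbf R^{2d}$, by $$(W(u),\Phi)=(U,A\Phi),\qquad (W_0(u),\Phi)=(U,A\Phi)-\mathbf E(U,A\Phi).$$ Then $\mathbf E\,W(u)\equiv(2\pi)^{-\frac d2}p$ as a tempered distribution, that is, $$\mathbf E(W(u),\Phi)=(2\pi)^{-\frac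 d2}p\int_{\mathbf R^{2d}}\overline{\Phi(x,\xi)}\,\mathrm dx\,\mathrm d\xi\qquad\text{for all }\Phi\in\mathscr S(\mathbf R^{2d}),$$ and $W_0(u)$ has zero mean and is white noise on $\mathbf R^{2d}$ with power $p^2$. -/

import Mathlib

open MeasureTheory ProbabilityTheory SchwartzMap
open scoped ComplexConjugate InnerProductSpace

set_option linter.unusedSectionVars false

noncomputable section

namespace PartialFourier

variable {E F V : Type} [NormedAddCommGroup E] [NormedSpace ℝ E]
  [NormedAddCommGroup F] [InnerProductSpace ℝ F]
  [NormedAddCommGroup V] [NormedSpace ℝ V] [NormedSpace ℂ V] [IsScalarTower ℝ ℂ V]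

theorem norm_exp_inner (y ξ : F) :
    ‖Complex.exp (Complex.I * (⟪y, ξ⟫_ℝ : ℂ))‖ = 1 := by
  rw [mul_comm]; exact Complex.norm_exp_ofReal_mul_I _

theorem norm_iteratedFDeriv_slice_le (Φ : 𝓢(E × F, V)) (x : E) (ξ : F) (n : ℕ) :
    ‖iteratedFDeriv ℝ n (fun ξ => Φ (x, ξ)) ξ‖ ≤ ‖iteratedFDeriv ℝ n Φ (x, ξ)‖ := by
  have h1 : (fun ξ => Φ (x, ξ)) =
      (fun w => Φ ((x, (0 : F)) + w)) ∘ (ContinuousLinearMap.inr ℝ E F) := by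
    ext ξ; simp
  have h2 : ContDiff ℝ (⊤ : ℕ∞) (fun w => Φ ((x, (0 : F)) + w)) :=
    (Φ.smooth ⊤).comp (by fun_prop)
  rw [h1, ContinuousLinearMap.iteratedFDeriv_comp_right _ h2 _ (by exact_mod_cast le_top)]
  refine (ContinuousMultilinearMap.norm_compContinuousLinearMap_le _ _).trans ?_
  rw [iteratedFDeriv_comp_add_left]
  have : ∏ _i : Fin n, ‖ContinuousLinearMap.inr ℝ E F‖ ≤ 1 :=
    Finset.prod_le_one (fun _ _ => by positivity)
      (fun _ _ => ContinuousLinearMap.norm_inr_le_one ℝ E F)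
  calc _ ≤ ‖iteratedFDeriv ℝ n Φ ((x, 0) + ContinuousLinearMap.inr ℝ E F ξ)‖ * 1 := by gcongr
    _ = _ := by simp

theorem slice_decay (Φ : 𝓢(E × F, V)) (x : E) (ξ : F) (k n : ℕ) :
    ‖ξ‖ ^ k * ‖iteratedFDeriv ℝ n (fun ξ => Φ (x, ξ)) ξ‖ ≤ SchwartzMap.seminorm ℝ k n Φ := by
  refine le_trans ?_ (le_seminorm ℝ k n Φ (x, ξ))
  gcongr
  · exact norm_snd_le (x, ξ)
  · exact norm_iteratedFDeriv_slice_le Φ x ξ n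

/-- Restriction of a Schwartz function on `E × F` to a slice `{x} × F`. -/
def slice (Φ : 𝓢(E × F, V)) (x : E) : 𝓢(F, V) where
  toFun ξ := Φ (x, ξ)
  smooth' := (Φ.smooth ⊤).comp (by fun_prop)
  decay' k n := ⟨SchwartzMap.seminorm ℝ k n Φ, fun ξ => slice_decay Φ x ξ k n⟩

theorem slice_apply (Φ : 𝓢(E × F, V)) (x : E) (ξ : F) : slice Φ x ξ = Φ (x, ξ) := rfl

theorem seminorm_slice_le (Φ : 𝓢(E × F, V)) (x : E) (k n : ℕ) :
    SchwartzMap.seminorm ℝ k n (slice Φ x) ≤ SchwartzMap.seminorm ℝ k n Φ :=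
  seminorm_le_bound ℝ k n _ (apply_nonneg _ _) fun ξ => slice_decay Φ x ξ k n

theorem sup_seminorm_slice_le (Φ : 𝓢(E × F, V)) (x : E) (s : Finset (ℕ × ℕ)) :
    s.sup (schwartzSeminormFamily ℝ F V) (slice Φ x) ≤
      s.sup (schwartzSeminormFamily ℝ (E × F) V) Φ := by
  refine Seminorm.finset_sup_apply_le (apply_nonneg _ _) fun i hi => ?_
  refine (seminorm_slice_le Φ x i.1 i.2).trans ?_
  exact Seminorm.le_def.1
    (Finset.le_sup (f := schwartzSeminormFamily ℝ (E × F) V) hi) Φ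

/-- The bilinear form `((x, ξ), (h, k)) ↦ ⟪ξ, k⟫`. -/
def sndInner : (E × F) →L[ℝ] (E × F) →L[ℝ] ℝ :=
  (innerSL ℝ : F →L[ℝ] F →L[ℝ] ℝ).bilinearComp
    (ContinuousLinearMap.snd ℝ E F) (ContinuousLinearMap.snd ℝ E F)

/-- The map `Φ ↦ ((x, ξ) ↦ ((h, k) ↦ DΦ(x, ξ)(h, 0) + i⟪ξ, k⟫ Φ(x, ξ)))`. -/
def derivSymbol : 𝓢(E × F, V) →L[ℝ] 𝓢(E × F, (E × F) →L[ℝ] V) :=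
  (postcompCLM ((ContinuousLinearMap.compL ℝ (E × F) (E × F) V).flip
      ((ContinuousLinearMap.inl ℝ E F).comp (ContinuousLinearMap.fst ℝ E F)))) ∘L
    (fderivCLM ℝ (E × F) V) +
  (postcompCLM (𝕜 := ℝ) ((Complex.I • ContinuousLinearMap.id ℂ
      ((E × F) →L[ℝ] V)).restrictScalars ℝ)) ∘L (smulRightCLM ℝ V sndInner)

theorem derivSymbol_apply (Φ : 𝓢(E × F, V)) (w : E × F) :
    derivSymbol Φ w = (fderiv ℝ Φ w).comp
      ((ContinuousLinearMap.inl ℝ E F).comp (ContinuousLinearMap.fst ℝ E F)) +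
      Complex.I • (sndInner w).smulRight (Φ w) := rfl

variable [FiniteDimensional ℝ F] [MeasurableSpace F] [BorelSpace F]

/-- The unnormalized inverse Fourier integral of `Φ` in the second variable. -/
def partialIntegral (Φ : 𝓢(E × F, V)) (z : E × F) : V :=
  ∫ ξ : F, Complex.exp (Complex.I * (⟪z.2, ξ⟫_ℝ : ℂ)) • Φ (z.1, ξ)

theorem partialIntegral_eq {V : Type} [NormedAddCommGroup V] [NormedSpace ℂ V]
    (Φ : 𝓢(E × F, V)) (z : E × F) :
    partialIntegral Φ z = FourierTransform.fourier (slice Φ z.1) (-(2 * Real.pi)⁻¹ • z.2) := by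
  rw [fourier_coe, Real.fourier_eq']
  refine integral_congr_ae (Filter.Eventually.of_forall fun ξ => ?_)
  simp only [slice_apply, real_inner_smul_right]
  congr 2
  rw [real_inner_comm]
  push_cast
  field_simp

theorem continuous_kernel (Φ : 𝓢(E × F, V)) (z : E × F) : Continuous
    (fun ξ : F => Complex.exp (Complex.I * (⟪z.2, ξ⟫_ℝ : ℂ)) • Φ (z.1, ξ)) :=
  Continuous.smul (by fun_prop) (slice Φ z.1).continuous

theorem integrable_kernel (Φ : 𝓢(E × F, V)) (z : E × F) : Integrable
    (fun ξ : F => Complex.exp (Complex.I * (⟪z.2, ξ⟫_ℝ : ℂ)) • Φ (z.1, ξ)) :=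
  (slice Φ z.1).integrable.mono (continuous_kernel Φ z).aestronglyMeasurable
    (Filter.Eventually.of_forall fun ξ => by
      rw [norm_smul, norm_exp_inner, one_mul, slice_apply])

theorem partialIntegral_add (Φ Ψ : 𝓢(E × F, V)) (z : E × F) :
    partialIntegral (Φ + Ψ) z = partialIntegral Φ z + partialIntegral Ψ z := by
  simp only [partialIntegral]
  rw [← integral_add (integrable_kernel Φ z) (integrable_kernel Ψ z)]
  exact integral_congr_ae (Filter.Eventually.of_forall fun ξ => smul_add _ _ _)

theorem partialIntegral_smul (a : ℂ) (Φ : 𝓢(E × F, V)) (z : E × F) :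
    partialIntegral (a • Φ) z = RingHom.id ℂ a • partialIntegral Φ z := by
  simp only [partialIntegral, RingHom.id_apply]
  rw [← integral_smul]
  exact integral_congr_ae (Filter.Eventually.of_forall fun ξ => smul_comm _ _ _)

theorem exists_integrable_bound (Φ : 𝓢(E × F, V)) :
    ∃ b : F → ℝ, Integrable b ∧ ∀ x ξ, ‖Φ (x, ξ)‖ ≤ b ξ := by
  set N := (volume : Measure F).integrablePower with hN
  refine ⟨fun ξ => (2 ^ N * (Finset.Iic (N, 0)).sup
    (fun m => SchwartzMap.seminorm ℝ m.1 m.2) Φ) * (1 + ‖ξ‖) ^ (-(N : ℝ)),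
    (Measure.integrable_pow_neg_integrablePower volume).const_mul _, fun x ξ => ?_⟩
  have h := one_add_le_sup_seminorm_apply (𝕜 := ℝ) (m := (N, 0)) le_rfl le_rfl Φ (x, ξ)
  rw [norm_iteratedFDeriv_zero] at h
  have hpos : 0 < (1 + ‖ξ‖) ^ N := by positivity
  beta_reduce
  rw [Real.rpow_neg (by positivity), Real.rpow_natCast, ← div_eq_mul_inv, le_div_iff₀ hpos,
    mul_comm]
  refine le_trans ?_ h
  gcongr
  exact norm_snd_le (x, ξ)

theorem hasFDerivAt_kernel (Φ : 𝓢(E × F, V)) (ξ : F) (z : E × F) :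
    HasFDerivAt (fun z : E × F => Complex.exp (Complex.I * (⟪z.2, ξ⟫_ℝ : ℂ)) • Φ (z.1, ξ))
      (Complex.exp (Complex.I * (⟪z.2, ξ⟫_ℝ : ℂ)) • derivSymbol Φ (z.1, ξ)) z := by
  have h1 : HasFDerivAt (fun z : E × F => (⟪z.2, ξ⟫_ℝ : ℝ)) (sndInner (0, ξ)) z := by
    have := (sndInner (E := E) (0, ξ)).hasFDerivAt (x := z)
    refine this.congr_of_eventuallyEq (Filter.Eventually.of_forall fun w => ?_)
    exact real_inner_comm _ _
  have h2 : HasFDerivAt (fun z : E × F => Complex.exp (Complex.I * (⟪z.2, ξ⟫_ℝ : ℂ)))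
      (Complex.exp (Complex.I * (⟪z.2, ξ⟫_ℝ : ℂ)) •
        (Complex.I • (Complex.ofRealCLM.comp (sndInner (0, ξ))))) z :=
    ((Complex.ofRealCLM.hasFDerivAt.comp z h1).const_mul Complex.I).cexp
  have h3 : HasFDerivAt (fun z : E × F => Φ (z.1, ξ)) ((fderiv ℝ Φ (z.1, ξ)).comp
      ((ContinuousLinearMap.inl ℝ E F).comp (ContinuousLinearMap.fst ℝ E F))) z := by
    have hg : HasFDerivAt (fun z : E × F => (z.1, ξ))
        ((ContinuousLinearMap.inl ℝ E F).comp (ContinuousLinearMap.fst ℝ E F)) z := by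
      have := (hasFDerivAt_fst (𝕜 := ℝ) (p := z)).prodMk (hasFDerivAt_const ξ z)
      exact this
    exact HasFDerivAt.comp z (Φ.hasFDerivAt (z.1, ξ)) hg
  convert! h2.smul h3 using 1
  rw [derivSymbol_apply]
  ext v
  · simp [sndInner]
  · have hc : ∀ (r : ℝ) (v : V), (r : ℂ) • v = r • v := fun r v => by
      rw [← one_smul ℂ v, ← smul_assoc r (1 : ℂ) v, one_smul, Complex.real_smul, mul_one]
    simp [sndInner, mul_smul, -Complex.coe_smul, hc]

theorem hasFDerivAt_partialIntegral (Φ : 𝓢(E × F, V)) (z : E × F) :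
    HasFDerivAt (partialIntegral Φ) (partialIntegral (derivSymbol Φ) z) z := by
  obtain ⟨b, hb, hbd⟩ := exists_integrable_bound (derivSymbol Φ)
  refine hasFDerivAt_integral_of_dominated_of_fderiv_le (bound := b) (s := Set.univ)
    Filter.univ_mem
    (Filter.Eventually.of_forall fun w => (continuous_kernel Φ w).aestronglyMeasurable)
    (integrable_kernel Φ z) (integrable_kernel (derivSymbol Φ) z).aestronglyMeasurable
    (Filter.Eventually.of_forall fun ξ w _ => ?_) hb
    (Filter.Eventually.of_forall fun ξ w _ => hasFDerivAt_kernel Φ ξ w)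
  rw [norm_smul, norm_exp_inner, one_mul]
  exact hbd _ _

theorem contDiff_partialIntegral (n : ℕ) : ∀ {V : Type} [NormedAddCommGroup V]
    [NormedSpace ℝ V] [NormedSpace ℂ V] [IsScalarTower ℝ ℂ V] (Φ : 𝓢(E × F, V)), ContDiff ℝ n (partialIntegral Φ) := by
  induction n with
  | zero =>
    intro V _ _ _ _ Φ
    exact contDiff_zero.2 (continuous_iff_continuousAt.2 fun z =>
      (hasFDerivAt_partialIntegral Φ z).continuousAt)
  | succ n ih =>
    intro V _ _ _ _ Φ
    exact_mod_cast contDiff_succ_iff_hasFDerivAt.2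
      ⟨_, ih (derivSymbol Φ), hasFDerivAt_partialIntegral Φ⟩

theorem realStructure_eq {V : Type} [NormedAddCommGroup V] [i : NormedSpace ℝ V] [NormedSpace ℂ V]
    [IsScalarTower ℝ ℂ V] : i = NormedSpace.complexToReal := by
  have h : ∀ (r : ℝ) (v : V), r • v = (r : ℂ) • v := fun r v => by
    rw [← one_smul ℂ v, ← smul_assoc, one_smul]
    simp
  have h2 : i.toModule = (NormedSpace.complexToReal : NormedSpace ℝ V).toModule :=
    Module.ext' _ _ h
  cases i
  congr

theorem partialIntegral_decay_zero (k : ℕ) : ∃ (s : Finset (ℕ × ℕ)) (C : ℝ), 0 ≤ C ∧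
    ∀ (Φ : 𝓢(E × F, V)) (z : E × F),
      ‖z‖ ^ k * ‖partialIntegral Φ z‖ ≤
        C * s.sup (schwartzSeminormFamily ℝ (E × F) V) Φ := by
  obtain rfl := realStructure_eq (V := V)
  let q : Seminorm ℝ 𝓢(F, V) := (SchwartzMap.seminorm ℝ k 0).comp
      (FourierTransform.fourierCLM ℝ 𝓢(F, V)).toLinearMap
  have hcont : Continuous q :=
    ((schwartz_withSeminorms ℝ F V).continuous_seminorm (k, 0)).comp
      (ContinuousFourier.continuous_fourier)
  obtain ⟨s, C, -, hC⟩ := Seminorm.bound_of_continuous (schwartz_withSeminorms ℝ F V) q hcont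
  set N := (volume : Measure F).integrablePower with hN
  set I := ∫ ξ : F, (1 + ‖ξ‖) ^ (-(N : ℝ)) with hI
  have hI0 : 0 ≤ I := integral_nonneg fun ξ => by positivity
  set t := Finset.Iic (k + N, 0) with ht
  refine ⟨s ∪ t, (2 * Real.pi) ^ k * C + 2 ^ (k + N) * I, by positivity, fun Φ z => ?_⟩
  set S := (s ∪ t).sup (schwartzSeminormFamily ℝ (E × F) V) Φ with hS
  have hS0 : 0 ≤ S := apply_nonneg _ _
  have hs : s.sup (schwartzSeminormFamily ℝ (E × F) V) Φ ≤ S :=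
    Seminorm.le_def.1 (Finset.sup_mono Finset.subset_union_left) Φ
  have ht : t.sup (schwartzSeminormFamily ℝ (E × F) V) Φ ≤ S :=
    Seminorm.le_def.1 (Finset.sup_mono Finset.subset_union_right) Φ
  -- decay in the frequency variable
  have h1 : ‖z.2‖ ^ k * ‖partialIntegral Φ z‖ ≤ (2 * Real.pi) ^ k * C * S := by
    have h3 := le_seminorm ℝ k 0 (FourierTransform.fourier (slice Φ z.1))
      (-(2 * Real.pi)⁻¹ • z.2)
    rw [norm_iteratedFDeriv_zero, ← partialIntegral_eq, norm_smul, norm_neg, norm_inv,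
      Real.norm_of_nonneg (by positivity), mul_pow, inv_pow] at h3
    have h4 : SchwartzMap.seminorm ℝ k 0 (FourierTransform.fourier (slice Φ z.1)) ≤ C * S :=
      (Seminorm.le_def.1 hC (slice Φ z.1)).trans
        (mul_le_mul_of_nonneg_left ((sup_seminorm_slice_le Φ z.1 s).trans hs) C.2)
    have h5 := h3.trans h4
    rw [mul_assoc, inv_mul_le_iff₀ (by positivity)] at h5
    linarith
  -- decay in the space variable
  have h2 : ‖z.1‖ ^ k * ‖partialIntegral Φ z‖ ≤ 2 ^ (k + N) * I * S := by
    have h3 : ∀ ξ : F, ‖z.1‖ ^ k * ‖Φ (z.1, ξ)‖ ≤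
        (2 ^ (k + N) * S) * (1 + ‖ξ‖) ^ (-(N : ℝ)) := fun ξ => by
      have h := one_add_le_sup_seminorm_apply (𝕜 := ℝ) (m := (k + N, 0)) le_rfl le_rfl Φ (z.1, ξ)
      rw [norm_iteratedFDeriv_zero] at h
      have hpos : 0 < (1 + ‖ξ‖) ^ N := by positivity
      rw [Real.rpow_neg (by positivity), Real.rpow_natCast, ← div_eq_mul_inv, le_div_iff₀ hpos]
      have hx : ‖z.1‖ ≤ 1 + ‖(z.1, ξ)‖ := by
        have := norm_fst_le (z.1, ξ); linarith
      have hy : 1 + ‖ξ‖ ≤ 1 + ‖(z.1, ξ)‖ := by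
        have := norm_snd_le (z.1, ξ); linarith
      calc ‖z.1‖ ^ k * ‖Φ (z.1, ξ)‖ * (1 + ‖ξ‖) ^ N
          ≤ (1 + ‖(z.1, ξ)‖) ^ k * ‖Φ (z.1, ξ)‖ * (1 + ‖(z.1, ξ)‖) ^ N := by gcongr
        _ = (1 + ‖(z.1, ξ)‖) ^ (k + N) * ‖Φ (z.1, ξ)‖ := by ring
        _ ≤ _ := h
        _ ≤ _ := by gcongr; exact ht
    calc ‖z.1‖ ^ k * ‖partialIntegral Φ z‖
        ≤ ‖z.1‖ ^ k * ∫ ξ : F, ‖Φ (z.1, ξ)‖ := by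
          gcongr
          refine (norm_integral_le_integral_norm _).trans (le_of_eq ?_)
          simp_rw [norm_smul, norm_exp_inner, one_mul]
      _ = ∫ ξ : F, ‖z.1‖ ^ k * ‖Φ (z.1, ξ)‖ := (integral_const_mul _ _).symm
      _ ≤ ∫ ξ : F, (2 ^ (k + N) * S) * (1 + ‖ξ‖) ^ (-(N : ℝ)) := by
          refine integral_mono ((slice Φ z.1).integrable.norm.const_mul _)
            ((Measure.integrable_pow_neg_integrablePower volume).const_mul _) h3
      _ = 2 ^ (k + N) * I * S := by rw [integral_const_mul]; ring
  have h6 : ‖z‖ ^ k ≤ ‖z.1‖ ^ k + ‖z.2‖ ^ k := by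
    rw [Prod.norm_def]
    rcases max_cases ‖z.1‖ ‖z.2‖ with h | h <;> rw [h.1]
    · exact le_add_of_nonneg_right (by positivity)
    · exact le_add_of_nonneg_left (by positivity)
  calc ‖z‖ ^ k * ‖partialIntegral Φ z‖
      ≤ (‖z.1‖ ^ k + ‖z.2‖ ^ k) * ‖partialIntegral Φ z‖ := by gcongr
    _ ≤ _ := by rw [add_mul, add_mul]; linarith

theorem continuous_sup_seminorm {D W : Type} [NormedAddCommGroup D] [NormedSpace ℝ D]
    [NormedAddCommGroup W] [NormedSpace ℝ W] (s : Finset (ℕ × ℕ)) :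
    Continuous (s.sup (schwartzSeminormFamily ℝ D W) : Seminorm ℝ 𝓢(D, W)) := by
  classical
  induction s using Finset.induction_on with
  | empty => exact continuous_const
  | insert i s _ ih =>
    rw [Finset.sup_insert]
    exact ((schwartz_withSeminorms ℝ D W).continuous_seminorm i).sup ih

theorem partialIntegral_decay (k n : ℕ) : ∀ {V : Type} [NormedAddCommGroup V]
    [NormedSpace ℝ V] [NormedSpace ℂ V] [IsScalarTower ℝ ℂ V],
    ∃ (s : Finset (ℕ × ℕ)) (C : ℝ), 0 ≤ C ∧ ∀ (Φ : 𝓢(E × F, V)) (z : E × F),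
      ‖z‖ ^ k * ‖iteratedFDeriv ℝ n (partialIntegral Φ) z‖ ≤
        C * s.sup (schwartzSeminormFamily ℝ (E × F) V) Φ := by
  induction n with
  | zero => intro V _ _ _ _; simpa using partialIntegral_decay_zero k
  | succ n ih =>
    intro V _ _ _ _
    obtain ⟨s, C, hC, h⟩ := ih (V := (E × F) →L[ℝ] V)
    have hcont : Continuous (fun Φ : 𝓢(E × F, V) =>
        s.sup (schwartzSeminormFamily ℝ (E × F) ((E × F) →L[ℝ] V)) (derivSymbol Φ)) :=
      (continuous_sup_seminorm s).comp derivSymbol.continuous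
    obtain ⟨t, D, -, hD⟩ := Seminorm.bound_of_continuous (schwartz_withSeminorms ℝ (E × F) V)
      ((s.sup (schwartzSeminormFamily ℝ (E × F) ((E × F) →L[ℝ] V))).comp
        derivSymbol.toLinearMap) hcont
    refine ⟨t, C * D, by positivity, fun Φ z => ?_⟩
    have h1 : fderiv ℝ (partialIntegral Φ) = partialIntegral (derivSymbol Φ) :=
      funext fun z => (hasFDerivAt_partialIntegral Φ z).fderiv
    rw [← norm_iteratedFDeriv_fderiv, h1, mul_assoc]
    exact (h _ z).trans (mul_le_mul_of_nonneg_left (Seminorm.le_def.1 hD Φ) hC)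

theorem sup_seminorm_real_eq_complex {D : Type} [NormedAddCommGroup D] [NormedSpace ℝ D]
    (s : Finset (ℕ × ℕ)) (Φ : 𝓢(D, ℂ)) :
    s.sup (schwartzSeminormFamily ℝ D ℂ) Φ = s.sup (schwartzSeminormFamily ℂ D ℂ) Φ := by
  rw [Seminorm.finset_sup_apply, Seminorm.finset_sup_apply]
  rfl

end PartialFourier

/-- The normalized inverse partial Fourier transform in the second variable, as a continuous
linear operator on the Schwartz space of `ℝᵈ × ℝᵈ`:
`Φ ↦ ((x, y) ↦ (2π)^(-d/2) ∫ e^{i⟨y, ξ⟩} Φ(x, ξ) dξ)`. -/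
def partialFourierInv (d : ℕ) :
    𝓢(EuclideanSpace ℝ (Fin d) × EuclideanSpace ℝ (Fin d), ℂ) →L[ℂ]
      𝓢(EuclideanSpace ℝ (Fin d) × EuclideanSpace ℝ (Fin d), ℂ) :=
  (((2 * Real.pi) ^ (-(d : ℝ) / 2) : ℝ) : ℂ) •
    mkCLM (𝕜 := ℂ) (𝕜' := ℂ) (σ := RingHom.id ℂ) (fun Φ z => PartialFourier.partialIntegral Φ z)
      PartialFourier.partialIntegral_add PartialFourier.partialIntegral_smul
      (fun Φ => contDiff_infty.2 fun n => PartialFourier.contDiff_partialIntegral n Φ)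
      (fun n => by
        obtain ⟨s, C, hC, h⟩ := PartialFourier.partialIntegral_decay
          (E := EuclideanSpace ℝ (Fin d)) (F := EuclideanSpace ℝ (Fin d)) n.1 n.2 (V := ℂ)
        refine ⟨s, C, hC, fun Φ z => ?_⟩
        rw [← PartialFourier.sup_seminorm_real_eq_complex]
        exact h Φ z)

theorem partialFourierInv_apply (d : ℕ)
    (Φ : 𝓢(EuclideanSpace ℝ (Fin d) × EuclideanSpace ℝ (Fin d), ℂ))
    (x y : EuclideanSpace ℝ (Fin d)) :
    partialFourierInv d Φ (x, y) = (((2 * Real.pi) ^ (-(d : ℝ) / 2) : ℝ) : ℂ) *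
      ∫ ξ : EuclideanSpace ℝ (Fin d), Complex.exp (Complex.I * (⟪y, ξ⟫_ℝ : ℂ)) * Φ (x, ξ) :=
  rfl

/-- The linear change of variables `κ(x, y) = (x + y/2, x - y/2)`, with inverse
`κ⁻¹(x, y) = ((x + y)/2, x - y)`. -/
def kappa (d : ℕ) :
    (EuclideanSpace ℝ (Fin d) × EuclideanSpace ℝ (Fin d)) ≃L[ℝ]
      (EuclideanSpace ℝ (Fin d) × EuclideanSpace ℝ (Fin d)) where
  toFun z := (z.1 + (1 / 2 : ℝ) • z.2, z.1 - (1 / 2 : ℝ) • z.2)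
  invFun z := ((1 / 2 : ℝ) • (z.1 + z.2), z.1 - z.2)
  map_add' z w := by ext <;> simp <;> ring
  map_smul' a z := by ext <;> simp <;> ring
  left_inv z := by ext <;> simp <;> ring
  right_inv z := by ext <;> simp <;> ring
  continuous_toFun := by fun_prop
  continuous_invFun := by fun_prop

/-- The operator `Φ ↦ (𝓕₂⁻¹ Φ) ∘ κ⁻¹` on the Schwartz space of `ℝᵈ × ℝᵈ`. -/
def wignerPullback (d : ℕ) :
    𝓢(EuclideanSpace ℝ (Fin d) × EuclideanSpace ℝ (Fin d), ℂ) →L[ℂ]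
      𝓢(EuclideanSpace ℝ (Fin d) × EuclideanSpace ℝ (Fin d), ℂ) :=
  (compCLMOfContinuousLinearEquiv ℂ (kappa d).symm).comp (partialFourierInv d)

theorem wignerPullback_apply (d : ℕ)
    (Φ : 𝓢(EuclideanSpace ℝ (Fin d) × EuclideanSpace ℝ (Fin d), ℂ))
    (x y : EuclideanSpace ℝ (Fin d)) :
    wignerPullback d Φ (x, y) = partialFourierInv d Φ ((1 / 2 : ℝ) • (x + y), x - y) :=
  rfl

/-- The Schwartz function `φ ⊗ ψ̄`, that is `(x, y) ↦ φ(x) * conj (ψ(y))`. -/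
def tensorConj {V : Type} [NormedAddCommGroup V] [NormedSpace ℝ V] (φ ψ : 𝓢(V, ℂ)) :
    𝓢(V × V, ℂ) where
  toFun z := φ z.1 * conj (ψ z.2)
  smooth' := by
    have h1 : ContDiff ℝ (⊤ : ℕ∞) (fun z : V × V => φ z.1) := (φ.smooth ⊤).comp contDiff_fst
    have h2 : ContDiff ℝ (⊤ : ℕ∞) (fun z : V × V => conj (ψ z.2)) :=
      Complex.conjCLE.contDiff.comp ((ψ.smooth ⊤).comp contDiff_snd)
    exact h1.mul h2
  decay' k n := by
    have h1 : ContDiff ℝ (⊤ : ℕ∞) (fun z : V × V => φ z.1) := (φ.smooth ⊤).comp contDiff_fst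
    have h2 : ContDiff ℝ (⊤ : ℕ∞) (fun z : V × V => conj (ψ z.2)) :=
      Complex.conjCLE.contDiff.comp ((ψ.smooth ⊤).comp contDiff_snd)
    have e1 : ∀ (i : ℕ) (z : V × V), ‖iteratedFDeriv ℝ i (fun z : V × V => φ z.1) z‖ ≤
        ‖iteratedFDeriv ℝ i φ z.1‖ := fun i z => by
      have := ContinuousLinearMap.iteratedFDeriv_comp_right (ContinuousLinearMap.fst ℝ V V)
        (φ.smooth ⊤) z (i := i) (by exact_mod_cast le_top)
      change ‖iteratedFDeriv ℝ i (φ ∘ ContinuousLinearMap.fst ℝ V V) z‖ ≤ _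
      rw [this]
      refine (ContinuousMultilinearMap.norm_compContinuousLinearMap_le _ _).trans ?_
      exact mul_le_of_le_one_right (norm_nonneg _) (Finset.prod_le_one
        (fun _ _ => by positivity) (fun _ _ => ContinuousLinearMap.norm_fst_le ℝ V V))
    have e2 : ∀ (i : ℕ) (z : V × V), ‖iteratedFDeriv ℝ i (fun z : V × V => conj (ψ z.2)) z‖ ≤
        ‖iteratedFDeriv ℝ i ψ z.2‖ := fun i z => by
      have h0 : ‖iteratedFDeriv ℝ i (fun z : V × V => conj (ψ z.2)) z‖ =
          ‖iteratedFDeriv ℝ i (fun z : V × V => ψ z.2) z‖ :=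
        LinearIsometryEquiv.norm_iteratedFDeriv_comp_left Complex.conjLIE
          (fun z : V × V => ψ z.2) z i
      rw [h0]
      have := ContinuousLinearMap.iteratedFDeriv_comp_right (ContinuousLinearMap.snd ℝ V V)
        (ψ.smooth ⊤) z (i := i) (by exact_mod_cast le_top)
      change ‖iteratedFDeriv ℝ i (ψ ∘ ContinuousLinearMap.snd ℝ V V) z‖ ≤ _
      rw [this]
      refine (ContinuousMultilinearMap.norm_compContinuousLinearMap_le _ _).trans ?_
      exact mul_le_of_le_one_right (norm_nonneg _) (Finset.prod_le_one
        (fun _ _ => by positivity) (fun _ _ => ContinuousLinearMap.norm_snd_le ℝ V V))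
    let q : ℕ → ℕ → 𝓢(V, ℂ) → ℝ := fun a b f => SchwartzMap.seminorm ℝ a b f
    refine ⟨∑ i ∈ Finset.range (n + 1), (n.choose i : ℝ) *
      (q k i φ * q 0 (n - i) ψ + q 0 i φ * q k (n - i) ψ), fun z => ?_⟩
    have h3 := norm_iteratedFDeriv_mul_le (N := ((⊤ : ℕ∞) : WithTop ℕ∞)) h1 h2 z (n := n) (by exact_mod_cast le_top)
    refine (mul_le_mul_of_nonneg_left h3 (by positivity)).trans ?_
    rw [Finset.mul_sum]
    refine Finset.sum_le_sum fun i _ => ?_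
    have hz : ‖z‖ ^ k ≤ ‖z.1‖ ^ k + ‖z.2‖ ^ k := by
      rw [Prod.norm_def]
      rcases max_cases ‖z.1‖ ‖z.2‖ with h | h <;> rw [h.1]
      · exact le_add_of_nonneg_right (by positivity)
      · exact le_add_of_nonneg_left (by positivity)
    have a1 : ‖z.1‖ ^ k * ‖iteratedFDeriv ℝ i φ z.1‖ ≤ q k i φ := le_seminorm ℝ k i φ z.1
    have a2 : ‖z.2‖ ^ k * ‖iteratedFDeriv ℝ (n - i) ψ z.2‖ ≤ q k (n - i) ψ :=
      le_seminorm ℝ k (n - i) ψ z.2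
    have a3 : ‖iteratedFDeriv ℝ i φ z.1‖ ≤ q 0 i φ :=
      norm_iteratedFDeriv_le_seminorm ℝ φ i z.1
    have a4 : ‖iteratedFDeriv ℝ (n - i) ψ z.2‖ ≤ q 0 (n - i) ψ :=
      norm_iteratedFDeriv_le_seminorm ℝ ψ (n - i) z.2
    have b1 : 0 ≤ q k i φ := apply_nonneg _ _
    have b3 : 0 ≤ q 0 i φ := apply_nonneg _ _
    calc _ ≤ (‖z.1‖ ^ k + ‖z.2‖ ^ k) * ((n.choose i : ℝ) * ‖iteratedFDeriv ℝ i φ z.1‖ *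
            ‖iteratedFDeriv ℝ (n - i) ψ z.2‖) := by
          gcongr
          · exact e1 i z
          · exact e2 (n - i) z
      _ = (n.choose i : ℝ) *
          ((‖z.1‖ ^ k * ‖iteratedFDeriv ℝ i φ z.1‖) * ‖iteratedFDeriv ℝ (n - i) ψ z.2‖ +
            ‖iteratedFDeriv ℝ i φ z.1‖ * (‖z.2‖ ^ k * ‖iteratedFDeriv ℝ (n - i) ψ z.2‖)) := by
          ring
      _ ≤ _ := by gcongr

theorem tensorConj_apply {V : Type} [NormedAddCommGroup V] [NormedSpace ℝ V] (φ ψ : 𝓢(V, ℂ))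
    (x y : V) : tensorConj φ ψ (x, y) = φ x * conj (ψ y) := rfl

/-- The expectation functional on `L²(Ω)`. -/
def expectationL2 {Ω : Type*} [MeasurableSpace Ω] (P : Measure Ω) [IsProbabilityMeasure P] :
    Lp ℂ 2 P →L[ℂ] ℂ where
  toFun X := ∫ ω, X ω ∂P
  map_add' X Y := by
    rw [← integral_add ((Lp.memLp X).integrable one_le_two) ((Lp.memLp Y).integrable one_le_two)]
    exact integral_congr_ae (Lp.coeFn_add X Y)
  map_smul' a X := by
    rw [RingHom.id_apply, ← integral_smul]
    exact integral_congr_ae (Lp.coeFn_smul a X)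
  cont := by
    have h : (fun X : Lp ℂ 2 P => ∫ ω, X ω ∂P) =
        fun X => inner ℂ (Lp.const 2 P (1 : ℂ)) X := by
      funext X
      rw [L2.inner_def]
      refine integral_congr_ae ?_
      filter_upwards [Lp.coeFn_const (p := 2) (μ := P) (1 : ℂ)] with ω hω
      rw [hω]
      simp
    change Continuous (fun X : Lp ℂ 2 P => ∫ ω, X ω ∂P)
    rw [h]
    fun_prop

/-- Subtraction of the mean on `L²(Ω)`: `X ↦ X - 𝔼 X`. -/
def centerL2 {Ω : Type*} [MeasurableSpace Ω] (P : Measure Ω) [IsProbabilityMeasure P] :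
    Lp ℂ 2 P →L[ℂ] Lp ℂ 2 P :=
  ContinuousLinearMap.id ℂ (Lp ℂ 2 P) - (Lp.constL 2 P ℂ).comp (expectationL2 P)

theorem centerL2_coeFn {Ω : Type*} [MeasurableSpace Ω] (P : Measure Ω) [IsProbabilityMeasure P]
    (X : Lp ℂ 2 P) : centerL2 P X =ᵐ[P] fun ω => X ω - ∫ ω', X ω' ∂P := by
  change (X - Lp.const 2 P (∫ ω', X ω' ∂P) : Lp ℂ 2 P) =ᵐ[P] _
  filter_upwards [Lp.coeFn_sub X (Lp.const 2 P (∫ ω', X ω' ∂P)),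
    Lp.coeFn_const (p := 2) (μ := P) (∫ ω', X ω' ∂P)] with ω h1 h2
  rw [h1, Pi.sub_apply, h2]
  rfl

/-- A tempered generalized stochastic process on `V`: a conjugate linear continuous operator
from the Schwartz space of `V` to `L²(Ω)`. -/
abbrev TemperedGSP (V : Type) [NormedAddCommGroup V] [NormedSpace ℝ V]
    {Ω : Type*} [MeasurableSpace Ω] (P : Measure Ω) : Type _ :=
  𝓢(V, ℂ) →L⋆[ℂ] Lp ℂ 2 P

namespace TemperedGSP

variable {V : Type} [NormedAddCommGroup V] [NormedSpace ℝ V] {Ω : Type*} [MeasurableSpace Ω]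
  {P : Measure Ω}

/-- The process takes values in `L₀²(Ω)`. -/
def IsZeroMean (u : TemperedGSP V P) : Prop :=
  ∀ φ : 𝓢(V, ℂ), ∫ ω, u φ ω ∂P = 0

/-- The process is Gaussian: for every finite family of test functions the random vector
`((u, φ₁), …, (u, φₙ))` of `ℂⁿ`, regarded as the real vector space `ℝ²ⁿ` of real and imaginary
parts, has a (possibly degenerate) real Gaussian law. -/
def IsGaussian (u : TemperedGSP V P) : Prop :=
  IsGaussianProcess (fun (φ : 𝓢(V, ℂ)) (ω : Ω) => u φ ω) P

/-- The process is symmetric: `c u` and `u` have the same (finite dimensional) probability laws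
for every complex number `c` of modulus one. -/
def IsSymmetric (u : TemperedGSP V P) : Prop :=
  ∀ c : ℂ, ‖c‖ = 1 → ∀ (n : ℕ) (φ : Fin n → 𝓢(V, ℂ)),
    IdentDistrib (fun ω j => c * u (φ j) ω) (fun ω j => u (φ j) ω) P P

/-- The covariance distribution on simple tensors, `(k_u, φ ⊗ ψ̄) = 𝔼 ((u, φ) conj (u, ψ))`. -/
def cov (u : TemperedGSP V P) (φ ψ : 𝓢(V, ℂ)) : ℂ :=
  ∫ ω, u φ ω * conj (u ψ ω) ∂P

/-- The mean of the process is the distribution given by the constant function `c`, that is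
`𝔼 (u, φ) = (c, φ) = ∫ c conj (φ(x)) dx` for all test functions `φ`. -/
def HasConstantMean [MeasureSpace V] (u : TemperedGSP V P) (c : ℂ) : Prop :=
  ∀ φ : 𝓢(V, ℂ), ∫ ω, u φ ω ∂P = ∫ x : V, c * conj (φ x)

/-- The process is (wide-sense) stationary: its mean is constant and its covariance distribution
is translation invariant. -/
def IsStationary [MeasureSpace V] (u : TemperedGSP V P) : Prop :=
  (∃ c : ℂ, u.HasConstantMean c) ∧
    ∀ (a : V) (φ ψ : 𝓢(V, ℂ)),
      u.cov (compSubConstCLM ℂ a φ) (compSubConstCLM ℂ a ψ) = u.cov φ ψ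

/-- White noise with power `p > 0`: a stationary process with
`(k_u, φ ⊗ ψ̄) = p (ψ, φ)_{L²}` for all test functions. -/
def IsWhiteNoise [MeasureSpace V] (u : TemperedGSP V P) (p : ℝ) : Prop :=
  0 < p ∧ u.IsStationary ∧
    ∀ φ ψ : 𝓢(V, ℂ), u.cov φ ψ = p * ∫ x : V, ψ x * conj (φ x)

/-- `U` is the process `u ⊗ ū` on `V × V`: `(U, φ ⊗ ψ̄) = (u, φ) conj (u, ψ)` almost surely. -/
def IsTensorSquare (u : TemperedGSP V P) (U : TemperedGSP (V × V) P) : Prop :=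
  ∀ φ ψ : 𝓢(V, ℂ), U (tensorConj φ ψ) =ᵐ[P] fun ω => u φ ω * conj (u ψ ω)

/-- The process `u - 𝔼 u`. -/
def center [IsProbabilityMeasure P] (u : TemperedGSP V P) : TemperedGSP V P :=
  (centerL2 P).comp u

/-- The process `Φ ↦ (U, (𝓕₂⁻¹ Φ) ∘ κ⁻¹)` on phase space. For `U = u ⊗ ū` it is the Wigner
distribution `W(u)`, and for `U - 𝔼 U` it is the zero mean Wigner distribution `W₀(u)`. -/
def wigner {d : ℕ}
    (U : TemperedGSP (EuclideanSpace ℝ (Fin d) × EuclideanSpace ℝ (Fin d)) P) :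
    TemperedGSP (EuclideanSpace ℝ (Fin d) × EuclideanSpace ℝ (Fin d)) P :=
  U.comp (wignerPullback d)

end TemperedGSP

end

/-! For tensors $F=\varphi\otimes\overline\psi$ and $G=\varphi'\otimes\overline{\psi'}$, Wick's
formula expresses the mixed fourth moment $\mathbf
E\big((u,\varphi)\overline{(u,\psi)}\,\overline{(u,\varphi')}(u,\psi')\big)$ by three pairings.
Symmetry kills the pairing with no conjugate between its factors, and white noise evaluates the
other two: the moment is $p^2\big(\int\overline F\,G+\overline{\delta(F)}\,\delta(G)\big)$ with
$\delta(F)=\int F(x,x)\,dx$. This is the inner product of $p(F,\delta F)$ and $p(G,\delta G)$ in the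
Hilbert space $L^2\oplus\mathbf C$ (`fourthMoment_eq_inner_noiseEmbedding`).

Hence the products $(u,\varphi)\overline{(u,\psi)}$ have the conjugate Gram matrix of the vectors
$p(F,\delta F)$, so a conjugate linear continuous operator maps the latter to the former
(`exists_conjLinear_of_gram`); composed with $F\mapsto p(F,\delta F)$ it is $U$. Tensors span a
dense subspace (`dense_span_tensorConj`), so $U$ is unique, and the formulas $\mathbf
E(U,F)=p\,\overline{\delta(F)}$ and $\mathbf E\big((U,F)\overline{(U,G)}\big)=p^2\big(\int\overline
F\,G+\overline{\delta(F)}\,\delta(G)\big)$ pass from tensors to all test functions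
(`IsTensorSquare.integral_eq`, `IsTensorSquare.cov_eq`).

Subtracting the mean removes exactly the rank one term $\overline{\delta(F)}\,\delta(G)$ and leaves
white noise with power $p^2$. The operator $A$ preserves the $L^2$ inner product, by Plancherel and
a change of variables of determinant of modulus one, so this survives on phase space
(`integral_conj_wignerPullback_mul`). The mean follows from $\delta(A\Phi)=(2\pi)^{-d/2}\int\Phi$
(`diagIntegral_wignerPullback`). -/

noncomputable section

namespace SchwartzMap

/-! ### Schwartz seminorms through weighted derivatives in a Banach space -/

section Jet

variable {W : Type} [NormedAddCommGroup W] [NormedSpace ℝ W]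

/-- Bounded continuous functions with values in the `n`-linear maps, with the supremum norm. -/
def BoundedJet (W : Type) [NormedAddCommGroup W] [NormedSpace ℝ W] (n : ℕ) : Type :=
  BoundedContinuousFunction W (ContinuousMultilinearMap ℝ (fun _ : Fin n => W) ℂ)

instance (n : ℕ) : NormedAddCommGroup (BoundedJet W n) :=
  (inferInstance : NormedAddCommGroup
    (BoundedContinuousFunction W (ContinuousMultilinearMap ℝ (fun _ : Fin n => W) ℂ)))

instance (n : ℕ) : NormedSpace ℂ (BoundedJet W n) :=
  (inferInstance : NormedSpace ℂ
    (BoundedContinuousFunction W (ContinuousMultilinearMap ℝ (fun _ : Fin n => W) ℂ)))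

instance (n : ℕ) : CompleteSpace (BoundedJet W n) :=
  (inferInstance : CompleteSpace
    (BoundedContinuousFunction W (ContinuousMultilinearMap ℝ (fun _ : Fin n => W) ℂ)))

/-- Evaluation at a point. -/
def BoundedJet.eval (n : ℕ) (x : W) :
    BoundedJet W n →L[ℂ] ContinuousMultilinearMap ℝ (fun _ : Fin n => W) ℂ :=
  BoundedContinuousFunction.evalCLM ℂ x

theorem BoundedJet.ext {n : ℕ} {F G : BoundedJet W n} (h : ∀ x, eval n x F = eval n x G) :
    F = G :=
  BoundedContinuousFunction.ext h

theorem BoundedJet.norm_le {n : ℕ} {F : BoundedJet W n} {C : ℝ} (hC : 0 ≤ C)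
    (h : ∀ x, ‖eval n x F‖ ≤ C) : ‖F‖ ≤ C :=
  (BoundedContinuousFunction.norm_le hC).2 h

theorem BoundedJet.norm_eval_le {n : ℕ} (F : BoundedJet W n) (x : W) : ‖eval n x F‖ ≤ ‖F‖ :=
  BoundedContinuousFunction.norm_coe_le_norm F x

/-- The bounded continuous function `x ↦ ‖x‖ ^ k • Dⁿ f(x)`. -/
def weightedDeriv (k n : ℕ) (f : 𝓢(W, ℂ)) :
    BoundedJet W n :=
  BoundedContinuousFunction.ofNormedAddCommGroup (fun x => ‖x‖ ^ k • iteratedFDeriv ℝ n f x)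
    ((continuous_norm.pow k).smul ((f.smooth ⊤).continuous_iteratedFDeriv (by exact_mod_cast le_top)))
    (SchwartzMap.seminorm ℝ k n f)
    (fun x => by simpa [norm_smul] using le_seminorm ℝ k n f x)

theorem eval_weightedDeriv (k n : ℕ) (f : 𝓢(W, ℂ)) (x : W) :
    BoundedJet.eval n x (weightedDeriv k n f) = ‖x‖ ^ k • iteratedFDeriv ℝ n f x := rfl

theorem seminorm_le_norm_weightedDeriv (k n : ℕ) (f : 𝓢(W, ℂ)) :
    SchwartzMap.seminorm ℂ k n f ≤ ‖weightedDeriv k n f‖ :=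
  seminorm_le_bound ℂ k n f (norm_nonneg (weightedDeriv k n f)) fun x => by
    simpa [eval_weightedDeriv, norm_smul] using (weightedDeriv k n f).norm_eval_le x

theorem weightedDeriv_add (k n : ℕ) (f g : 𝓢(W, ℂ)) :
    weightedDeriv k n (f + g) = weightedDeriv k n f + weightedDeriv k n g := by
  refine BoundedJet.ext fun x => ?_
  have : iteratedFDeriv ℝ n (⇑f + ⇑g) x = iteratedFDeriv ℝ n f x + iteratedFDeriv ℝ n g x :=
    iteratedFDeriv_add_apply (f.smooth n).contDiffAt (g.smooth n).contDiffAt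
  change ‖x‖ ^ k • iteratedFDeriv ℝ n (⇑f + ⇑g) x = _
  rw [this, smul_add]
  rfl

theorem weightedDeriv_smul (k n : ℕ) (c : ℂ) (f : 𝓢(W, ℂ)) :
    weightedDeriv k n (c • f) = c • weightedDeriv k n f := by
  refine BoundedJet.ext fun x => ?_
  have : iteratedFDeriv ℝ n (c • ⇑f) x = c • iteratedFDeriv ℝ n f x :=
    iteratedFDeriv_const_smul_apply (f.smooth n).contDiffAt
  change ‖x‖ ^ k • iteratedFDeriv ℝ n (c • ⇑f) x = _
  rw [this, smul_comm]
  rfl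

/-- The target of the weighted derivatives with indices in a finite set. -/
abbrev JetSpace (W : Type) [NormedAddCommGroup W] [NormedSpace ℝ W] (s : Finset (ℕ × ℕ)) : Type :=
  (i : s) → BoundedJet W i.1.2

/-- Finitely many weighted derivatives of a Schwartz function. -/
def jet (s : Finset (ℕ × ℕ)) : 𝓢(W, ℂ) →ₗ[ℂ] JetSpace W s where
  toFun f i := weightedDeriv i.1.1 i.1.2 f
  map_add' f g := funext fun _ => weightedDeriv_add _ _ f g
  map_smul' c f := funext fun _ => weightedDeriv_smul _ _ c f

/-- Approximation of `jet s f` in the Banach space `JetSpace W s` is therefore approximation of `f`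
in a basic neighbourhood of the Schwartz topology. This lets Bochner integrals stand in for
integrals with values in the Schwartz space. -/
theorem sup_seminorm_le_norm_jet (s : Finset (ℕ × ℕ)) (f : 𝓢(W, ℂ)) :
    s.sup (schwartzSeminormFamily ℂ W ℂ) f ≤ ‖jet s f‖ :=
  Seminorm.finset_sup_apply_le (norm_nonneg _) fun i hi =>
    (seminorm_le_norm_weightedDeriv i.1 i.2 f).trans (norm_le_pi_norm (jet s f) ⟨i, hi⟩)

theorem iteratedFDeriv_compSubConst (n : ℕ) (f : 𝓢(W, ℂ)) (w x : W) :
    iteratedFDeriv ℝ n (compSubConstCLM ℂ w f) x = iteratedFDeriv ℝ n f (x - w) :=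
  iteratedFDeriv_comp_sub n w x (f := f)

/-- The weight at `x` is traded for a weight at the nearby point `y` through
$\|x\|\le(1+a)(1+\|y\|)$. -/
theorem pow_mul_norm_iteratedFDeriv_le (k n : ℕ) (f : 𝓢(W, ℂ)) {a : ℝ} (ha : 0 ≤ a) {x y : W}
    (h : ‖x‖ ≤ ‖y‖ + a) :
    ‖x‖ ^ k * ‖iteratedFDeriv ℝ n f y‖ ≤ (1 + a) ^ k *
      (2 ^ k * (Finset.Iic (k, n)).sup (schwartzSeminormFamily ℝ W ℂ) f) := by
  have h1 := one_add_le_sup_seminorm_apply (𝕜 := ℝ) (m := (k, n)) le_rfl le_rfl f y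
  have h2 : ‖x‖ ≤ (1 + a) * (1 + ‖y‖) := by
    nlinarith [norm_nonneg y]
  calc ‖x‖ ^ k * ‖iteratedFDeriv ℝ n f y‖
      ≤ ((1 + a) * (1 + ‖y‖)) ^ k * ‖iteratedFDeriv ℝ n f y‖ := by gcongr
    _ = (1 + a) ^ k * ((1 + ‖y‖) ^ k * ‖iteratedFDeriv ℝ n f y‖) := by rw [mul_pow, mul_assoc]
    _ ≤ _ := mul_le_mul_of_nonneg_left h1 (by positivity)

/-- Only polynomial growth in `w` matters: a Schwartz function of `w` absorbs it in
`integrable_smul_jet`. -/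
theorem norm_weightedDeriv_compSubConst_le (k n : ℕ) (f : 𝓢(W, ℂ)) (w : W) :
    ‖weightedDeriv k n (compSubConstCLM ℂ w f)‖ ≤ (1 + ‖w‖) ^ k *
      (2 ^ k * (Finset.Iic (k, n)).sup (schwartzSeminormFamily ℝ W ℂ) f) := by
  refine BoundedJet.norm_le (by positivity) fun x => ?_
  rw [eval_weightedDeriv, norm_smul, norm_pow, norm_norm, iteratedFDeriv_compSubConst]
  refine pow_mul_norm_iteratedFDeriv_le k n f (norm_nonneg w) ?_
  simpa using norm_add_le (x - w) w

/-- Mean value inequality on the unit ball around `x - v`, at the cost of one more derivative. There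
$\|x\|\le\|y\|+1+\|v\|$, which gives the factor `2 + ‖v‖`. -/
theorem norm_weightedDeriv_compSubConst_sub_le (k n : ℕ) (f : 𝓢(W, ℂ)) (v w : W)
    (h : ‖w - v‖ ≤ 1) :
    ‖weightedDeriv k n (compSubConstCLM ℂ w f) - weightedDeriv k n (compSubConstCLM ℂ v f)‖ ≤
      ((2 + ‖v‖) ^ k * (2 ^ k *
        (Finset.Iic (k, n + 1)).sup (schwartzSeminormFamily ℝ W ℂ) f)) * ‖w - v‖ := by
  refine BoundedJet.norm_le (by positivity) fun x => ?_
  rw [map_sub, eval_weightedDeriv, eval_weightedDeriv,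
    iteratedFDeriv_compSubConst, iteratedFDeriv_compSubConst]
  have hd : Differentiable ℝ (iteratedFDeriv ℝ n f) :=
    (f.smooth ⊤).differentiable_iteratedFDeriv (by exact_mod_cast WithTop.coe_lt_top n)
  have key := Convex.norm_image_sub_le_of_norm_fderiv_le (𝕜 := ℝ)
    (f := fun y => ‖x‖ ^ k • iteratedFDeriv ℝ n f y) (s := Metric.closedBall (x - v) 1)
    (x := x - v) (y := x - w)
    (C := (2 + ‖v‖) ^ k * (2 ^ k *
        (Finset.Iic (k, n + 1)).sup (schwartzSeminormFamily ℝ W ℂ) f))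
    (fun y _ => (hd y).fun_const_smul _) (fun y hy => ?_) (convex_closedBall _ _)
    (Metric.mem_closedBall_self zero_le_one)
    (by rw [mem_closedBall_iff_norm, ← norm_neg]; simpa using h)
  · refine key.trans (le_of_eq ?_)
    rw [← norm_neg (w - v)]
    congr 2
    abel
  · rw [fderiv_fun_const_smul (hd y), norm_smul, norm_pow, norm_norm, norm_fderiv_iteratedFDeriv]
    have hxy : ‖x‖ ≤ ‖y‖ + (1 + ‖v‖) := by
      have h1 : ‖y - (x - v)‖ ≤ 1 := mem_closedBall_iff_norm.1 hy
      have h2 : x = y - (y - (x - v)) + v := by abel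
      calc ‖x‖ = ‖y - (y - (x - v)) + v‖ := by rw [← h2]
        _ ≤ ‖y - (y - (x - v))‖ + ‖v‖ := norm_add_le _ _
        _ ≤ ‖y‖ + ‖y - (x - v)‖ + ‖v‖ := by gcongr; exact norm_sub_le _ _
        _ ≤ _ := by linarith
    have := pow_mul_norm_iteratedFDeriv_le k (n + 1) f (by positivity) hxy
    rwa [← add_assoc, one_add_one_eq_two] at this

theorem continuous_jet_compSubConst (s : Finset (ℕ × ℕ)) (f : 𝓢(W, ℂ)) :
    Continuous fun w => jet s (compSubConstCLM ℂ w f) := by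
  refine continuous_pi fun i => continuous_iff_continuousAt.2 fun v => ?_
  refine continuousAt_of_locally_lipschitz (r := 1) one_pos ((2 + ‖v‖) ^ i.1.1 * (2 ^ i.1.1 *
    (Finset.Iic (i.1.1, i.1.2 + 1)).sup (schwartzSeminormFamily ℝ W ℂ) f)) fun w hw => ?_
  rw [dist_eq_norm w v] at hw ⊢
  exact (dist_eq_norm (weightedDeriv i.1.1 i.1.2 (compSubConstCLM ℂ w f))
    (weightedDeriv i.1.1 i.1.2 (compSubConstCLM ℂ v f))).trans_le
    (norm_weightedDeriv_compSubConst_sub_le i.1.1 i.1.2 f v w hw.le)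

end Jet

end SchwartzMap

namespace SchwartzMap

/-! ### Density of tensor products by convolution with an approximate identity -/

section Convolution

variable {W : Type} [NormedAddCommGroup W] [NormedSpace ℝ W] [FiniteDimensional ℝ W]
  [MeasurableSpace W] [BorelSpace W] (μ : Measure W) [μ.IsAddHaarMeasure]

theorem continuous_iteratedFDeriv (n : ℕ) (f : 𝓢(W, ℂ)) : Continuous (iteratedFDeriv ℝ n f) :=
  (f.smooth ⊤).continuous_iteratedFDeriv (by exact_mod_cast le_top)

theorem integrable_smul_iteratedFDeriv (n : ℕ) (f g : 𝓢(W, ℂ)) (x : W) :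
    Integrable (fun w => f w • iteratedFDeriv ℝ n g (x - w)) μ := by
  refine ((f.integrable (μ := μ)).norm.mul_const (SchwartzMap.seminorm ℝ 0 n g)).mono'
    (f.continuous.smul ((continuous_iteratedFDeriv n g).comp
      (continuous_const.sub continuous_id))).aestronglyMeasurable (.of_forall fun w => ?_)
  rw [norm_smul]
  gcongr
  exact norm_iteratedFDeriv_le_seminorm ℝ g n _

theorem iteratedFDeriv_integral_smul_comp_sub (n : ℕ) (f g : 𝓢(W, ℂ)) (x : W) :
    iteratedFDeriv ℝ n (fun x => ∫ w, f w • g (x - w) ∂μ) x =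
      ∫ w, f w • iteratedFDeriv ℝ n g (x - w) ∂μ := by
  induction n generalizing x with
  | zero =>
    ext m
    rw [iteratedFDeriv_zero_apply, ContinuousMultilinearMap.integral_apply
      (integrable_smul_iteratedFDeriv μ 0 f g x)]
    simp
  | succ n ih =>
    have hd : Differentiable ℝ (iteratedFDeriv ℝ n g) :=
      (g.smooth ⊤).differentiable_iteratedFDeriv (by exact_mod_cast WithTop.coe_lt_top n)
    -- Currying identifies this integrand with the one of order `n + 1`, already known to be
    -- integrable.
    have hmeas : AEStronglyMeasurable
        (fun w => f w • fderiv ℝ (iteratedFDeriv ℝ n g) (x - w)) μ := by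
      refine ((continuousMultilinearCurryLeftEquiv ℝ
        (fun _ : Fin (n + 1) => W) ℂ).continuous.comp_aestronglyMeasurable
        (integrable_smul_iteratedFDeriv μ (n + 1) f g x).aestronglyMeasurable).congr
        (.of_forall fun w => ?_)
      rfl
    have hderiv : HasFDerivAt (fun x => ∫ w, f w • iteratedFDeriv ℝ n g (x - w) ∂μ)
        (∫ w, f w • fderiv ℝ (iteratedFDeriv ℝ n g) (x - w) ∂μ) x := by
      refine hasFDerivAt_integral_of_dominated_of_fderiv_le (s := Set.univ)
        (F' := fun y w => f w • fderiv ℝ (iteratedFDeriv ℝ n g) (y - w))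
        (bound := fun w => ‖f w‖ * SchwartzMap.seminorm ℝ 0 (n + 1) g) Filter.univ_mem
        (.of_forall fun y => (integrable_smul_iteratedFDeriv μ n f g y).aestronglyMeasurable)
        (integrable_smul_iteratedFDeriv μ n f g x)
        hmeas
        (.of_forall fun w y _ => ?_) ((f.integrable (μ := μ)).norm.mul_const _)
        (.of_forall fun w y _ => ?_)
      · rw [norm_smul, norm_fderiv_iteratedFDeriv]
        gcongr
        exact norm_iteratedFDeriv_le_seminorm ℝ g (n + 1) _
      · have h1 := (hd (y - w)).hasFDerivAt.comp y ((hasFDerivAt_id y).sub_const w)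
        have h2 := ((f w • ContinuousLinearMap.id ℂ (ContinuousMultilinearMap ℝ
          (fun _ : Fin n => W) ℂ)).restrictScalars ℝ).hasFDerivAt.comp y h1
        exact h2
    rw [iteratedFDeriv_succ_eq_comp_left, Function.comp_apply, funext ih, hderiv.fderiv]
    exact (ContinuousLinearEquiv.integral_comp_comm (𝕜 := ℝ) (μ := μ)
      (E := W →L[ℝ] ContinuousMultilinearMap ℝ (fun _ : Fin n => W) ℂ)
      (F := ContinuousMultilinearMap ℝ (fun _ : Fin (n + 1) => W) ℂ)
      (continuousMultilinearCurryLeftEquiv ℝ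
        (fun _ : Fin (n + 1) => W) ℂ).symm.toContinuousLinearEquiv _).symm

/-- Both sides are the `n`-th derivative of the same convolution, since $f*g=g*f$. -/
theorem integral_smul_iteratedFDeriv_comm (n : ℕ) (f g : 𝓢(W, ℂ)) (x : W) :
    ∫ w, f w • iteratedFDeriv ℝ n g (x - w) ∂μ = ∫ w, g w • iteratedFDeriv ℝ n f (x - w) ∂μ := by
  rw [← iteratedFDeriv_integral_smul_comp_sub, ← iteratedFDeriv_integral_smul_comp_sub]
  congr 2
  funext y
  rw [← integral_sub_left_eq_self (fun w => g w • f (y - w)) μ y]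
  simp [mul_comm]

theorem integrable_smul_jet (s : Finset (ℕ × ℕ)) (f g : 𝓢(W, ℂ)) :
    Integrable (fun w => f w • jet s (compSubConstCLM ℂ w g)) μ := by
  refine Integrable.of_eval fun i => ?_
  have hi := ((continuous_apply i).comp
    (f.continuous.smul (continuous_jet_compSubConst s g))).aestronglyMeasurable (μ := μ)
  obtain ⟨C, hC⟩ : ∃ C : ℝ, ∀ w, ‖weightedDeriv i.1.1 i.1.2 (compSubConstCLM ℂ w g)‖ ≤
      (1 + ‖w‖) ^ i.1.1 * C := ⟨_, norm_weightedDeriv_compSubConst_le i.1.1 i.1.2 g⟩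
  have hint : Integrable (fun w => (1 + ‖w‖ ^ i.1.1) * ‖f w‖ * (2 ^ i.1.1 * C)) μ := by
    simp_rw [add_mul]
    exact ((f.integrable.norm.const_mul 1).mul_const _).add
      ((f.integrable_pow_mul μ i.1.1).mul_const _)
  have hC0 : 0 ≤ C := by
    have := (norm_nonneg _).trans (hC 0)
    simpa using this
  refine hint.mono' hi (.of_forall fun w => ?_)
  change ‖f w • weightedDeriv i.1.1 i.1.2 (compSubConstCLM ℂ w g)‖ ≤ _
  rw [norm_smul]
  have h1 : (1 + ‖w‖) ^ i.1.1 ≤ 2 ^ i.1.1 * (1 + ‖w‖ ^ i.1.1) := by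
    refine (add_pow_le zero_le_one (norm_nonneg w) i.1.1).trans ?_
    rw [one_pow]
    gcongr
    · norm_num
    · exact Nat.sub_le _ _
  calc ‖f w‖ * ‖weightedDeriv i.1.1 i.1.2 (compSubConstCLM ℂ w g)‖
      ≤ ‖f w‖ * ((2 ^ i.1.1 * (1 + ‖w‖ ^ i.1.1)) * C) := by
        gcongr
        exact (hC w).trans (by gcongr)
    _ = _ := by ring

/-- Commutativity of convolution at the level of jets: an average of translates of `f` weighted by
`g` is also an average of translates of `g`. Evaluation at a point is continuous on jets and passes
under the integral, which reduces the claim to pointwise derivatives. -/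
theorem integral_smul_jet_comm (s : Finset (ℕ × ℕ)) (f g : 𝓢(W, ℂ)) :
    ∫ w, f w • jet s (compSubConstCLM ℂ w g) ∂μ =
      ∫ w, g w • jet s (compSubConstCLM ℂ w f) ∂μ := by
  have key : ∀ (f g : 𝓢(W, ℂ)) (i : s) (x : W),
      BoundedJet.eval i.1.2 x ((∫ w, f w • jet s (compSubConstCLM ℂ w g) ∂μ) i) =
        ‖x‖ ^ i.1.1 • ∫ w, f w • iteratedFDeriv ℝ i.1.2 g (x - w) ∂μ := fun f g i x => by
    have h := integrable_smul_jet μ s f g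
    have h1 := ContinuousLinearMap.integral_comp_comm
      ((BoundedJet.eval i.1.2 x).comp (ContinuousLinearMap.proj (R := ℂ)
        (φ := fun i : s => BoundedJet W i.1.2) i)) h
    refine h1.symm.trans ?_
    rw [← integral_smul]
    refine integral_congr_ae (.of_forall fun w => ?_)
    change f w • ‖x‖ ^ i.1.1 • iteratedFDeriv ℝ i.1.2 (compSubConstCLM ℂ w g) x = _
    rw [iteratedFDeriv_compSubConst, smul_comm]
  funext i
  refine BoundedJet.ext fun x => ?_
  rw [key, key, integral_smul_iteratedFDeriv_comm]

/-- A subspace of the Schwartz space that contains all translates of an approximate identity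
is dense. -/
theorem dense_of_translates_approxIdentity (T : Submodule ℂ 𝓢(W, ℂ))
    (hT : ∀ δ > 0, ∃ g : 𝓢(W, ℂ), (∀ w, compSubConstCLM ℂ w g ∈ T) ∧
      (∀ w, g w ≠ 0 → ‖w‖ < δ) ∧ ∫ w, g w ∂μ = 1 ∧ ∫ w, ‖g w‖ ∂μ = 1) :
    Dense (T : Set 𝓢(W, ℂ)) := by
  intro f
  refine mem_closure_iff_nhds_basis ((schwartz_withSeminorms ℂ W ℂ).hasBasis_ball) |>.2 ?_
  rintro ⟨s, r⟩ (hr : 0 < r)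
  obtain ⟨δ, hδ, hf⟩ := Metric.continuousAt_iff.1
    ((continuous_jet_compSubConst s f).continuousAt (x := 0)) (r / 2) (half_pos hr)
  obtain ⟨g, hgT, hgs, hg1, hgn⟩ := hT δ hδ
  -- The integral of translates of `g` lies in the closed span `M` because its image in the quotient
  -- by `M` is the integral of zero.
  let M : Submodule ℂ (JetSpace W s) := (T.map (jet s)).topologicalClosure
  have hMc : IsClosed (M : Set (JetSpace W s)) := Submodule.isClosed_topologicalClosure _
  have hmem : ∫ w, g w • jet s (compSubConstCLM ℂ w f) ∂μ ∈ M := by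
    rw [integral_smul_jet_comm, ← Submodule.Quotient.mk_eq_zero]
    have h1 := M.mkQL.integral_comp_comm (integrable_smul_jet μ s f g)
    refine h1.symm.trans (integral_eq_zero_of_ae (.of_forall fun w => ?_))
    refine (Submodule.Quotient.mk_eq_zero M).2 (M.smul_mem _ ?_)
    exact Submodule.le_topologicalClosure _ ⟨_, hgT w, rfl⟩
  -- As `g` has integral one, the difference is the `g`-average of `jet s f` minus its translates;
  -- on the support of `g` these are within `r / 2`, and `g` has $L^1$ norm one.
  have hdist : ‖jet s f - ∫ w, g w • jet s (compSubConstCLM ℂ w f) ∂μ‖ ≤ r / 2 := by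
    have h1 : jet s f = ∫ w, g w • jet s f ∂μ := by
      rw [integral_smul_const, hg1, one_smul]
    have h2 : Integrable (fun w => g w • jet s f) μ := g.integrable.smul_const _
    conv_lhs => rw [h1]
    rw [← integral_sub h2 (integrable_smul_jet μ s g f)]
    calc _ ≤ ∫ w, ‖g w‖ * (r / 2) ∂μ := by
          refine norm_integral_le_of_norm_le (g.integrable.norm.mul_const _)
            (.of_forall fun w => ?_)
          rw [← smul_sub, norm_smul]
          by_cases hw : g w = 0
          · simp [hw]
          · gcongr
            have := hf (x := w) (by simpa using hgs w hw)
            rw [dist_comm, dist_eq_norm, compSubConstCLM_zero] at this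
            exact this.le
      _ = r / 2 := by rw [integral_mul_const, hgn, one_mul]
  obtain ⟨_, ⟨t, ht, rfl⟩, htr⟩ := Metric.mem_closure_iff.1 hmem (r / 2) (half_pos hr)
  refine ⟨t, ht, ?_⟩
  rw [Seminorm.mem_ball, ← map_neg_eq_map, neg_sub]
  refine (sup_seminorm_le_norm_jet s _).trans_lt ?_
  rw [map_sub]
  rw [dist_eq_norm] at htr
  calc _ ≤ _ := norm_sub_le_norm_sub_add_norm_sub _
        (∫ w, g w • jet s (compSubConstCLM ℂ w f) ∂μ) _
    _ < r / 2 + r / 2 := add_lt_add_of_le_of_lt hdist htr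
    _ = r := add_halves r

end Convolution

theorem compSubConstCLM_tensorConj {V : Type} [NormedAddCommGroup V] [NormedSpace ℝ V]
    (φ ψ : 𝓢(V, ℂ)) (w : V × V) : compSubConstCLM ℂ w (tensorConj φ ψ) =
      tensorConj (compSubConstCLM ℂ w.1 φ) (compSubConstCLM ℂ w.2 ψ) := rfl

/-- The tensor products span a dense subspace of the Schwartz space of a product. -/
theorem dense_span_tensorConj (V : Type) [NormedAddCommGroup V] [InnerProductSpace ℝ V]
    [FiniteDimensional ℝ V] [MeasurableSpace V] [BorelSpace V] :
    Dense (Submodule.span ℂ (Set.range fun q : 𝓢(V, ℂ) × 𝓢(V, ℂ) => tensorConj q.1 q.2) :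
      Set 𝓢(V × V, ℂ)) := by
  refine dense_of_translates_approxIdentity ((volume : Measure V).prod volume) _ fun δ hδ => ?_
  -- The bump is real, so the conjugation in the second factor is invisible, and nonnegative, so the
  -- $L^1$ norm equals the integral. The product norm is a maximum, so the tensor square still
  -- vanishes outside the `δ`-ball.
  let b : ContDiffBump (0 : V) := ⟨δ / 2, δ, half_pos hδ, half_lt_self hδ⟩
  let f : V → ℂ := fun x => (b.normed volume x : ℂ)
  have hfc : HasCompactSupport f := b.hasCompactSupport_normed.comp_left Complex.ofReal_zero
  have hfs : ContDiff ℝ (⊤ : ℕ∞) f := Complex.ofRealCLM.contDiff.comp b.contDiff_normed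
  let η : 𝓢(V, ℂ) := hfc.toSchwartzMap hfs
  have hη : ∀ w : V × V, tensorConj η η w =
      ((b.normed volume w.1 * b.normed volume w.2 : ℝ) : ℂ) := fun w => by
    change f w.1 * conj (f w.2) = _
    simp [f]
  have hint : ∫ w : V × V, b.normed volume w.1 * b.normed volume w.2
      ∂(volume : Measure V).prod volume = 1 := by
    rw [integral_prod_mul (b.normed volume) (b.normed volume),
      b.integral_normed, one_mul]
  refine ⟨tensorConj η η, fun w => ?_, fun w hw => ?_, ?_, ?_⟩
  · rw [compSubConstCLM_tensorConj]
    exact Submodule.subset_span ⟨(_, _), rfl⟩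
  · rw [hη, Complex.ofReal_mul, mul_ne_zero_iff, Complex.ofReal_ne_zero,
      Complex.ofReal_ne_zero] at hw
    have h : ∀ x : V, b.normed volume x ≠ 0 → ‖x‖ < δ := fun x hx => by
      have : x ∈ Function.support (b.normed volume) := hx
      rw [b.support_normed_eq] at this
      simpa using this
    exact max_lt (h _ hw.1) (h _ hw.2)
  · simp_rw [hη]
    rw [integral_complex_ofReal, hint, Complex.ofReal_one]
  · simp_rw [hη, Complex.norm_real, Real.norm_of_nonneg
      (mul_nonneg (b.nonneg_normed _) (b.nonneg_normed _))]
    exact hint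

end SchwartzMap

/-! ### Fourth moments of centered Gaussian variables -/

section Isserlis

variable {Ω : Type*} [MeasurableSpace Ω] {P : Measure Ω}

/-- The moment generating function is $e^{vt^2/2}$, finite everywhere, and its fourth derivative at
zero is $3v^2$. The degenerate case $v=0$ is included. -/
theorem integral_pow_four_of_hasGaussianLaw {X : Ω → ℝ} (hX : HasGaussianLaw X P)
    (h0 : ∫ ω, X ω ∂P = 0) : ∫ ω, X ω ^ 4 ∂P = 3 * (∫ ω, X ω ^ 2 ∂P) ^ 2 := by
  have hP := hX.isProbabilityMeasure
  have hlaw := hX.map_eq_gaussianReal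
  have hvar : Var[X; P] = ∫ ω, X ω ^ 2 ∂P := variance_of_integral_eq_zero hX.aemeasurable h0
  rw [h0] at hlaw
  set v : ℝ := ∫ ω, X ω ^ 2 ∂P with hv
  have hv0 : 0 ≤ v := integral_nonneg fun ω => sq_nonneg _
  have hmgf : mgf X P = fun t => Real.exp (v * t ^ 2 / 2) := by
    funext t
    rw [mgf_gaussianReal hlaw, hvar, Real.coe_toNNReal _ hv0, zero_mul, zero_add]
  have hint : (0 : ℝ) ∈ interior (integrableExpSet X P) := by
    have : integrableExpSet X P = Set.univ := by
      have h2 := integrableExpSet_id_gaussianReal (μ := 0) (v := Var[X; P].toNNReal)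
      rw [← hlaw] at h2
      refine Set.eq_univ_of_forall fun t => ?_
      have h3 : t ∈ integrableExpSet id (P.map X) := h2 ▸ Set.mem_univ t
      exact (integrable_map_measure (by fun_prop) hX.aemeasurable).1 h3
    rw [this, interior_univ]
    trivial
  have hmom := iteratedDeriv_mgf_zero hint 4
  -- Differentiation maps $q\,e^{vt^2/2}$ to $(q'+vtq)\,e^{vt^2/2}$, so polynomial factors persist
  -- and alternate between even and odd; zero coefficients below pad them to the shapes of `hd` and
  -- `hd'`.
  have hpoly : ∀ (q q' : ℝ → ℝ), (∀ t, HasDerivAt q (q' t) t) →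
      deriv (fun t => q t * Real.exp (v * t ^ 2 / 2)) =
        fun t => (q' t + v * t * q t) * Real.exp (v * t ^ 2 / 2) := fun q q' hq => by
    funext t
    have he : HasDerivAt (fun t : ℝ => Real.exp (v * t ^ 2 / 2))
        (Real.exp (v * t ^ 2 / 2) * (v * t)) t := by
      refine HasDerivAt.exp ?_
      have := (((hasDerivAt_id t).pow 2).const_mul v).div_const 2
      refine this.congr_deriv ?_
      simp
      ring
    rw [((hq t).fun_mul he).deriv]
    ring
  have hd : ∀ a b c t : ℝ, HasDerivAt (fun t : ℝ => a + b * t ^ 2 + c * t ^ 4)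
      (2 * b * t + 4 * c * t ^ 3) t := fun a b c t => by
    refine ((((hasDerivAt_id t).pow 2).const_mul b).const_add a |>.add
      (((hasDerivAt_id t).pow 4).const_mul c)).congr_deriv ?_
    simp
    ring
  have hd' : ∀ a b t : ℝ, HasDerivAt (fun t : ℝ => a * t + b * t ^ 3)
      (a + 3 * b * t ^ 2) t := fun a b t => by
    refine (((hasDerivAt_id t).const_mul a).add
      (((hasDerivAt_id t).pow 3).const_mul b)).congr_deriv ?_
    simp
    ring
  have e0 : mgf X P = fun t => (1 + 0 * t ^ 2 + 0 * t ^ 4) * Real.exp (v * t ^ 2 / 2) := by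
    rw [hmgf]; funext t; ring
  have e1 : deriv (mgf X P) = fun t => (v * t + 0 * t ^ 3) * Real.exp (v * t ^ 2 / 2) := by
    rw [e0, hpoly _ _ (hd 1 0 0)]; funext t; ring
  have e2 : deriv (deriv (mgf X P)) =
      fun t => (v + v ^ 2 * t ^ 2 + 0 * t ^ 4) * Real.exp (v * t ^ 2 / 2) := by
    rw [e1, hpoly _ _ (hd' v 0)]; funext t; ring
  have e3 : deriv (deriv (deriv (mgf X P))) =
      fun t => (3 * v ^ 2 * t + v ^ 3 * t ^ 3) * Real.exp (v * t ^ 2 / 2) := by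
    rw [e2, hpoly _ _ (hd v (v ^ 2) 0)]; funext t; ring
  rw [iteratedDeriv_succ, iteratedDeriv_succ, iteratedDeriv_succ, iteratedDeriv_succ,
    iteratedDeriv_zero, e3, hpoly _ _ (hd' _ _)] at hmom
  simpa using hmom.symm

variable [IsProbabilityMeasure P]

theorem integrable_mul_of_memLp_four {X Y : Ω → ℂ} (hX : MemLp X 4 P) (hY : MemLp Y 4 P) :
    Integrable (fun ω => X ω * Y ω) P :=
  memLp_one_iff_integrable.1 (((hY.mono_exponent (p := 2) (by norm_num)).mul'
    (hX.mono_exponent (p := 2) (by norm_num))))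

theorem MemLp.mul_of_four {X Y : Ω → ℂ} (hX : MemLp X 4 P) (hY : MemLp Y 4 P) :
    MemLp (fun ω => X ω * Y ω) 2 P := by
  have : ENNReal.HolderTriple 4 4 2 := ⟨by
    rw [← two_mul, show (4 : ENNReal) = 2 * 2 by norm_num,
      ENNReal.mul_inv (by simp) (by simp), ← mul_assoc, ENNReal.mul_inv_cancel (by simp) (by simp),
      one_mul]⟩
  exact hY.mul' hX

theorem integrable_mul_mul_mul_of_memLp_four {X Y Z W : Ω → ℂ} (hX : MemLp X 4 P)
    (hY : MemLp Y 4 P) (hZ : MemLp Z 4 P) (hW : MemLp W 4 P) :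
    Integrable (fun ω => X ω * Y ω * Z ω * W ω) P := by
  simp_rw [mul_assoc (_ * _)]
  exact memLp_one_iff_integrable.1 ((MemLp.mul_of_four hZ hW).mul' (MemLp.mul_of_four hX hY))

variable (P) in
/-- Wick's formula for the fourth mixed moment of four random variables. -/
def WickFour (X Y Z W : Ω → ℂ) : Prop :=
  ∫ ω, X ω * Y ω * Z ω * W ω ∂P =
    (∫ ω, X ω * Y ω ∂P) * (∫ ω, Z ω * W ω ∂P) + (∫ ω, X ω * Z ω ∂P) * (∫ ω, Y ω * W ω ∂P) +
      (∫ ω, X ω * W ω ∂P) * (∫ ω, Y ω * Z ω ∂P)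

/-- With this cyclic invariance, linearity in the first slot alone gives linearity in all four. -/
theorem WickFour.rotate {X Y Z W : Ω → ℂ} (h : WickFour P X Y Z W) : WickFour P Y Z W X := by
  unfold WickFour at h ⊢
  have e1 : ∀ ω, Y ω * Z ω * W ω * X ω = X ω * Y ω * Z ω * W ω := fun ω => by ring
  simp_rw [e1, h, mul_comm (Y _) (X _), mul_comm (Z _) (X _), mul_comm (W _) (X _)]
  ring

theorem WickFour.congr {X Y Z W X' Y' Z' W' : Ω → ℂ} (h : WickFour P X Y Z W) (hX : X =ᵐ[P] X')
    (hY : Y =ᵐ[P] Y') (hZ : Z =ᵐ[P] Z') (hW : W =ᵐ[P] W') : WickFour P X' Y' Z' W' := by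
  unfold WickFour at h ⊢
  have e : ∀ {A B A' B' : Ω → ℂ}, A =ᵐ[P] A' → B =ᵐ[P] B' →
      ∫ ω, A ω * B ω ∂P = ∫ ω, A' ω * B' ω ∂P := fun hA hB => integral_congr_ae (hA.mul hB)
  have e4 : ∫ ω, X ω * Y ω * Z ω * W ω ∂P = ∫ ω, X' ω * Y' ω * Z' ω * W' ω ∂P :=
    integral_congr_ae (((hX.mul hY).mul hZ).mul hW)
  rw [← e4, ← e hX hY, ← e hX hZ, ← e hX hW, ← e hY hZ, ← e hY hW, ← e hZ hW]
  exact h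

theorem WickFour.add_mul {A B Y Z W : Ω → ℂ} (hA : MemLp A 4 P) (hB : MemLp B 4 P)
    (hY : MemLp Y 4 P) (hZ : MemLp Z 4 P) (hW : MemLp W 4 P) (c : ℂ)
    (h1 : WickFour P A Y Z W) (h2 : WickFour P B Y Z W) :
    WickFour P (fun ω => A ω + c * B ω) Y Z W := by
  unfold WickFour at *
  have e : ∀ X : Ω → ℂ, MemLp X 4 P → ∫ ω, (A ω + c * B ω) * X ω ∂P =
      ∫ ω, A ω * X ω ∂P + c * ∫ ω, B ω * X ω ∂P := fun X hX => by
    rw [← integral_const_mul, ← integral_add (integrable_mul_of_memLp_four hA hX)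
      ((integrable_mul_of_memLp_four hB hX).const_mul c)]
    congr 1; funext ω; ring
  have e4 : ∫ ω, (A ω + c * B ω) * Y ω * Z ω * W ω ∂P =
      ∫ ω, A ω * Y ω * Z ω * W ω ∂P + c * ∫ ω, B ω * Y ω * Z ω * W ω ∂P := by
    rw [← integral_const_mul, ← integral_add (integrable_mul_mul_mul_of_memLp_four hA hY hZ hW)
      ((integrable_mul_mul_mul_of_memLp_four hB hY hZ hW).const_mul c)]
    congr 1; funext ω; ring
  rw [e4, e Y hY, e Z hZ, e W hW, h1, h2]
  ring

/-- Isserlis' theorem for four random variables all of whose linear combinations have the fourth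
moment of a centered Gaussian variable. -/
theorem wickFour_ofReal {x y z w : Ω → ℝ} (hx : MemLp x 4 P) (hy : MemLp y 4 P)
    (hz : MemLp z 4 P) (hw : MemLp w 4 P)
    (h : ∀ a b c : ℝ, ∫ ω, (x ω + a * y ω + b * z ω + c * w ω) ^ 4 ∂P =
      3 * (∫ ω, (x ω + a * y ω + b * z ω + c * w ω) ^ 2 ∂P) ^ 2) :
    WickFour P (fun ω => (x ω : ℂ)) (fun ω => (y ω : ℂ)) (fun ω => (z ω : ℂ))
      (fun ω => (w ω : ℂ)) := by
  have i2 : ∀ {f g : Ω → ℝ}, MemLp f 4 P → MemLp g 4 P → Integrable (fun ω => f ω * g ω) P :=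
    fun {f g} hf hg => memLp_one_iff_integrable.1 ((hg.mono_exponent (p := 2) (by norm_num)).mul'
      (hf.mono_exponent (p := 2) (by norm_num)))
  have hlin : ∀ a b c : ℝ, MemLp (fun ω => x ω + a * y ω + b * z ω + c * w ω) 4 P :=
    fun a b c => ((hx.add (hy.const_mul a)).add (hz.const_mul b)).add (hw.const_mul c)
  have i4 : ∀ a b c : ℝ, Integrable (fun ω => (x ω + a * y ω + b * z ω + c * w ω) ^ 4) P :=
    fun a b c => by
      have := (hlin a b c).integrable_norm_pow (p := 4) (by norm_num)
      refine this.congr (.of_forall fun ω => ?_)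
      simp only [Real.norm_eq_abs]
      rw [Even.pow_abs (by decide)]
  have hsq : ∀ a b c : ℝ, ∫ ω, (x ω + a * y ω + b * z ω + c * w ω) ^ 2 ∂P =
      ∫ ω, x ω * x ω ∂P + a ^ 2 * ∫ ω, y ω * y ω ∂P + b ^ 2 * ∫ ω, z ω * z ω ∂P +
      c ^ 2 * ∫ ω, w ω * w ω ∂P + 2 * a * ∫ ω, x ω * y ω ∂P + 2 * b * ∫ ω, x ω * z ω ∂P +
      2 * c * ∫ ω, x ω * w ω ∂P + 2 * a * b * ∫ ω, y ω * z ω ∂P +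
      2 * a * c * ∫ ω, y ω * w ω ∂P + 2 * b * c * ∫ ω, z ω * w ω ∂P := fun a b c => by
    have hxx := i2 hx hx
    have hyy := i2 hy hy
    have hzz := i2 hz hz
    have hww := i2 hw hw
    have hxy := i2 hx hy
    have hxz := i2 hx hz
    have hxw := i2 hx hw
    have hyz := i2 hy hz
    have hyw := i2 hy hw
    have hzw := i2 hz hw
    simp_rw [← integral_const_mul]
    rw [← integral_add (by fun_prop) (by fun_prop), ← integral_add (by fun_prop) (by fun_prop),
      ← integral_add (by fun_prop) (by fun_prop), ← integral_add (by fun_prop) (by fun_prop),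
      ← integral_add (by fun_prop) (by fun_prop), ← integral_add (by fun_prop) (by fun_prop),
      ← integral_add (by fun_prop) (by fun_prop), ← integral_add (by fun_prop) (by fun_prop),
      ← integral_add (by fun_prop) (by fun_prop)]
    congr 1; funext ω; ring
  -- Polarization: the eight fourth powers, signed by the product of their coefficients, cancel
  -- every monomial except $xyzw$, which occurs $8\cdot 24=192$ times.
  have hpol : ∫ ω, x ω * y ω * z ω * w ω ∂P = (1 / 192) *
      ((∫ ω, (x ω + 1 * y ω + 1 * z ω + 1 * w ω) ^ 4 ∂P) -
        (∫ ω, (x ω + 1 * y ω + 1 * z ω + (-1) * w ω) ^ 4 ∂P) -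
        (∫ ω, (x ω + 1 * y ω + (-1) * z ω + 1 * w ω) ^ 4 ∂P) -
        (∫ ω, (x ω + (-1) * y ω + 1 * z ω + 1 * w ω) ^ 4 ∂P) +
        (∫ ω, (x ω + 1 * y ω + (-1) * z ω + (-1) * w ω) ^ 4 ∂P) +
        (∫ ω, (x ω + (-1) * y ω + 1 * z ω + (-1) * w ω) ^ 4 ∂P) +
        (∫ ω, (x ω + (-1) * y ω + (-1) * z ω + 1 * w ω) ^ 4 ∂P) -
        (∫ ω, (x ω + (-1) * y ω + (-1) * z ω + (-1) * w ω) ^ 4 ∂P)) := by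
    have j1 := i4 1 1 1
    have j2 := i4 1 1 (-1)
    have j3 := i4 1 (-1) 1
    have j4 := i4 (-1) 1 1
    have j5 := i4 1 (-1) (-1)
    have j6 := i4 (-1) 1 (-1)
    have j7 := i4 (-1) (-1) 1
    have j8 := i4 (-1) (-1) (-1)
    rw [← integral_sub j1 j2, ← integral_sub (by fun_prop) j3,
      ← integral_sub (by fun_prop) j4, ← integral_add (by fun_prop) j5,
      ← integral_add (by fun_prop) j6, ← integral_add (by fun_prop) j7,
      ← integral_sub (by fun_prop) j8, ← integral_const_mul]
    refine integral_congr_ae (.of_forall fun ω => ?_)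
    ring
  have key : ∫ ω, x ω * y ω * z ω * w ω ∂P =
      (∫ ω, x ω * y ω ∂P) * (∫ ω, z ω * w ω ∂P) + (∫ ω, x ω * z ω ∂P) * (∫ ω, y ω * w ω ∂P) +
      (∫ ω, x ω * w ω ∂P) * (∫ ω, y ω * z ω ∂P) := by
    rw [hpol]
    simp only [h, hsq]
    ring
  unfold WickFour
  simp_rw [← Complex.ofReal_mul, integral_complex_ofReal, key]
  push_cast
  ring

end Isserlis

/-! ### Fourth moments of a symmetric Gaussian process -/

namespace TemperedGSP

variable {V : Type} [NormedAddCommGroup V] [NormedSpace ℝ V] {Ω : Type*} [MeasurableSpace Ω]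
  {P : Measure Ω} [IsProbabilityMeasure P] {u : TemperedGSP V P}

theorem coeFn_add (u : TemperedGSP V P) (φ ψ : 𝓢(V, ℂ)) :
    u (φ + ψ) =ᵐ[P] fun ω => u φ ω + u ψ ω := by
  rw [map_add]; exact Lp.coeFn_add _ _

theorem coeFn_smul (u : TemperedGSP V P) (a : ℂ) (φ : 𝓢(V, ℂ)) :
    u (a • φ) =ᵐ[P] fun ω => conj a * u φ ω := by
  rw [map_smulₛₗ]; exact Lp.coeFn_smul _ _

namespace IsGaussian

theorem memLp_four (hu : u.IsGaussian) (φ : 𝓢(V, ℂ)) : MemLp (u φ) 4 P :=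
  (IsGaussianProcess.hasGaussianLaw_eval hu φ).memLp (by norm_num)

theorem memLp_conj_four (hu : u.IsGaussian) (φ : 𝓢(V, ℂ)) :
    MemLp (fun ω => conj (u φ ω)) 4 P := (hu.memLp_four φ).star

theorem memLp_re_four (hu : u.IsGaussian) (φ : 𝓢(V, ℂ)) :
    MemLp (fun ω => (u φ ω).re) 4 P := (hu.memLp_four φ).re

theorem integral_re_pow_four (hu : u.IsGaussian) (h0 : u.IsZeroMean) (φ : 𝓢(V, ℂ)) :
    ∫ ω, (u φ ω).re ^ 4 ∂P = 3 * (∫ ω, (u φ ω).re ^ 2 ∂P) ^ 2 := by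
  refine integral_pow_four_of_hasGaussianLaw
    ((IsGaussianProcess.hasGaussianLaw_eval hu φ).map_fun Complex.reCLM) ?_
  change ∫ ω, RCLike.re (u φ ω) ∂P = 0
  rw [integral_re ((hu.memLp_four φ).integrable (by norm_num)), h0 φ, map_zero]

/-- Real scalars are unaffected by conjugation, so a real combination of the variables
$\mathrm{Re}(u,\varphi_i)$ is again the real part of `u` at one test function, hence centered
Gaussian. -/
theorem wickFour_re (hu : u.IsGaussian) (h0 : u.IsZeroMean) (φ₁ φ₂ φ₃ φ₄ : 𝓢(V, ℂ)) :
    WickFour P (fun ω => ((u φ₁ ω).re : ℂ)) (fun ω => ((u φ₂ ω).re : ℂ))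
      (fun ω => ((u φ₃ ω).re : ℂ)) (fun ω => ((u φ₄ ω).re : ℂ)) := by
  refine wickFour_ofReal (hu.memLp_re_four _) (hu.memLp_re_four _) (hu.memLp_re_four _)
    (hu.memLp_re_four _) fun a b c => ?_
  have h := hu.integral_re_pow_four h0
    (φ₁ + (a : ℂ) • φ₂ + (b : ℂ) • φ₃ + (c : ℂ) • φ₄)
  have hae : ∀ᵐ ω ∂P, (u (φ₁ + (a : ℂ) • φ₂ + (b : ℂ) • φ₃ + (c : ℂ) • φ₄) ω).re =
      (u φ₁ ω).re + a * (u φ₂ ω).re + b * (u φ₃ ω).re + c * (u φ₄ ω).re := by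
    filter_upwards [u.coeFn_add (φ₁ + (a : ℂ) • φ₂ + (b : ℂ) • φ₃) ((c : ℂ) • φ₄),
      u.coeFn_add (φ₁ + (a : ℂ) • φ₂) ((b : ℂ) • φ₃), u.coeFn_add φ₁ ((a : ℂ) • φ₂),
      u.coeFn_smul a φ₂, u.coeFn_smul b φ₃, u.coeFn_smul c φ₄] with ω h1 h2 h3 h4 h5 h6
    rw [h1, h2, h3, h4, h5, h6]
    simp
  rwa [integral_congr_ae (hae.mono fun ω hω => congrArg (· ^ _) hω :
      (fun ω => (u (φ₁ + (a : ℂ) • φ₂ + (b : ℂ) • φ₃ + (c : ℂ) • φ₄) ω).re ^ 4) =ᵐ[P]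
        fun ω => ((u φ₁ ω).re + a * (u φ₂ ω).re + b * (u φ₃ ω).re + c * (u φ₄ ω).re) ^ 4),
    integral_congr_ae (hae.mono fun ω hω => congrArg (· ^ _) hω :
      (fun ω => (u (φ₁ + (a : ℂ) • φ₂ + (b : ℂ) • φ₃ + (c : ℂ) • φ₄) ω).re ^ 2) =ᵐ[P]
        fun ω => ((u φ₁ ω).re + a * (u φ₂ ω).re + b * (u φ₃ ω).re + c * (u φ₄ ω).re) ^ 2)] at h

/-- Each round extends the first slot by linearity and rotates it to the back; four rounds restore
the order. -/
theorem wickFour_re_add_mul (hu : u.IsGaussian) (h0 : u.IsZeroMean) (φ φ' : Fin 4 → 𝓢(V, ℂ))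
    (c : Fin 4 → ℂ) :
    WickFour P (fun ω => ((u (φ 0) ω).re : ℂ) + c 0 * ((u (φ' 0) ω).re : ℂ))
      (fun ω => ((u (φ 1) ω).re : ℂ) + c 1 * ((u (φ' 1) ω).re : ℂ))
      (fun ω => ((u (φ 2) ω).re : ℂ) + c 2 * ((u (φ' 2) ω).re : ℂ))
      (fun ω => ((u (φ 3) ω).re : ℂ) + c 3 * ((u (φ' 3) ω).re : ℂ)) := by
  have hr : ∀ φ, MemLp (fun ω => ((u φ ω).re : ℂ)) 4 P := fun φ => (hu.memLp_re_four φ).ofReal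
  have hc : ∀ i, MemLp (fun ω => ((u (φ i) ω).re : ℂ) + c i * ((u (φ' i) ω).re : ℂ)) 4 P :=
    fun i => (hr _).add ((hr _).const_mul _)
  have h1 : ∀ φ₂ φ₃ φ₄ : 𝓢(V, ℂ), WickFour P
      (fun ω => ((u φ₂ ω).re : ℂ)) (fun ω => ((u φ₃ ω).re : ℂ)) (fun ω => ((u φ₄ ω).re : ℂ))
      (fun ω => ((u (φ 0) ω).re : ℂ) + c 0 * ((u (φ' 0) ω).re : ℂ)) := fun φ₂ φ₃ φ₄ =>
    (WickFour.add_mul (hr _) (hr _) (hr _) (hr _) (hr _) (c 0) (hu.wickFour_re h0 _ _ _ _)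
      (hu.wickFour_re h0 _ _ _ _)).rotate
  have h2 := fun φ₃ φ₄ => (WickFour.add_mul (hr _) (hr _) (hr _) (hr _) (hc 0) (c 1)
    (h1 (φ 1) φ₃ φ₄) (h1 (φ' 1) φ₃ φ₄)).rotate
  have h3 := fun φ₄ => (WickFour.add_mul (hr _) (hr _) (hr _) (hc 0) (hc 1) (c 2)
    (h2 (φ 2) φ₄) (h2 (φ' 2) φ₄)).rotate
  exact (WickFour.add_mul (hr _) (hr _) (hc 0) (hc 1) (hc 2) (c 3) (h3 (φ 3)) (h3 (φ' 3))).rotate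

/-- Conjugate linearity gives $(u,i\varphi)=-i(u,\varphi)$, whose real part is
$\mathrm{Im}(u,\varphi)$. Real parts of `u` thus suffice for the complex Wick formula. -/
theorem coeFn_eq_re_add (u : TemperedGSP V P) (φ : 𝓢(V, ℂ)) :
    (fun ω => ((u φ ω).re : ℂ) + Complex.I * ((u (Complex.I • φ) ω).re : ℂ)) =ᵐ[P] u φ := by
  filter_upwards [u.coeFn_smul Complex.I φ] with ω h
  rw [h]
  apply Complex.ext <;> simp

theorem coeFn_conj_eq_re_add (u : TemperedGSP V P) (φ : 𝓢(V, ℂ)) :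
    (fun ω => ((u φ ω).re : ℂ) + -Complex.I * ((u (Complex.I • φ) ω).re : ℂ)) =ᵐ[P]
      fun ω => conj (u φ ω) := by
  filter_upwards [u.coeFn_smul Complex.I φ] with ω h
  rw [h]
  apply Complex.ext <;> simp

theorem wickFour_conj (hu : u.IsGaussian) (h0 : u.IsZeroMean) (φ₁ φ₂ φ₃ φ₄ : 𝓢(V, ℂ)) :
    WickFour P (u φ₁) (fun ω => conj (u φ₂ ω)) (fun ω => conj (u φ₃ ω)) (u φ₄) := by
  have h := hu.wickFour_re_add_mul h0 ![φ₁, φ₂, φ₃, φ₄]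
    (fun i => Complex.I • ![φ₁, φ₂, φ₃, φ₄] i) ![Complex.I, -Complex.I, -Complex.I, Complex.I]
  exact WickFour.congr h (coeFn_eq_re_add u φ₁) (coeFn_conj_eq_re_add u φ₂) (coeFn_conj_eq_re_add u φ₃)
    (coeFn_eq_re_add u φ₄)

end IsGaussian

/-- Multiplying `u` by $i$ preserves the joint law but reverses the sign of the product, so the
expectation is its own negative. -/
theorem IsSymmetric.integral_mul_eq_zero (hs : u.IsSymmetric) (φ ψ : 𝓢(V, ℂ)) :
    ∫ ω, u φ ω * u ψ ω ∂P = 0 := by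
  have h := (hs Complex.I (by simp) 2 ![φ, ψ]).comp (u := fun v : Fin 2 → ℂ => v 0 * v 1)
    (by fun_prop)
  have h2 := h.integral_eq
  simp only [Function.comp_def, Matrix.cons_val_zero, Matrix.cons_val_one] at h2
  have e : ∀ ω, Complex.I * u φ ω * (Complex.I * u ψ ω) = -(u φ ω * u ψ ω) := fun ω => by
    linear_combination (u φ ω * u ψ ω) * Complex.I_mul_I
  simp_rw [e, integral_neg] at h2
  exact self_eq_neg.1 h2.symm

theorem integral_conj_mul_eq (u : TemperedGSP V P) (φ ψ : 𝓢(V, ℂ)) :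
    ∫ ω, conj (u φ ω) * u ψ ω ∂P = conj (u.cov φ ψ) := by
  rw [cov, ← integral_conj]
  simp

/-- The fourth moments of a centered symmetric Gaussian process. -/
theorem IsGaussian.integral_mul_conj_mul_conj (hu : u.IsGaussian) (h0 : u.IsZeroMean)
    (hs : u.IsSymmetric) (φ ψ φ' ψ' : 𝓢(V, ℂ)) :
    ∫ ω, u φ ω * conj (u ψ ω) * conj (u φ' ω * conj (u ψ' ω)) ∂P =
      u.cov φ ψ * conj (u.cov φ' ψ') + u.cov φ φ' * conj (u.cov ψ ψ') := by
  have h := hu.wickFour_conj h0 φ ψ φ' ψ'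
  unfold WickFour at h
  rw [integral_conj_mul_eq, integral_conj_mul_eq, hs.integral_mul_eq_zero, zero_mul, add_zero] at h
  refine Eq.trans ?_ h
  congr 1
  funext ω
  simp
  ring

end TemperedGSP

/-- If the Gram matrix of `b` is the conjugate of the Gram matrix of `a`, there is a conjugate
linear continuous operator that maps `a i` to `b i`. -/
theorem exists_conjLinear_of_gram {ι K H : Type*} [NormedAddCommGroup K] [InnerProductSpace ℂ K]
    [CompleteSpace K] [NormedAddCommGroup H] [InnerProductSpace ℂ H] [CompleteSpace H]
    (a : ι → K) (b : ι → H) (h : ∀ i j, ⟪b i, b j⟫_ℂ = ⟪a j, a i⟫_ℂ) :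
    ∃ J : K →L⋆[ℂ] H, ∀ i, J (a i) = b i := by
  let M : Submodule ℂ K := (Submodule.span ℂ (Set.range a)).topologicalClosure
  have hM : ∀ i, a i ∈ M := fun i =>
    Submodule.le_topologicalClosure _ (Submodule.subset_span ⟨i, rfl⟩)
  have : CompleteSpace M := (Submodule.isClosed_topologicalClosure _).completeSpace_coe
  let e : (ι →₀ ℂ) →ₗ[ℂ] M := Finsupp.linearCombination ℂ fun i => ⟨a i, hM i⟩
  let f : (ι →₀ ℂ) →ₛₗ[starRingEnd ℂ] H :=
    { toFun := fun c => c.sum fun i z => conj z • b i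
      map_add' := fun c c' => Finsupp.sum_add_index' (by simp) (by simp [add_smul])
      map_smul' := fun z c => by
        rw [Finsupp.sum_smul_index' (by simp), Finsupp.smul_sum]
        simp [mul_smul] }
  have he : ∀ c, (e c : K) = c.sum fun i z => z • a i := fun c => by
    simp [e, Finsupp.linearCombination_apply, Finsupp.sum]
  -- The conjugated Gram matrix and the conjugated coefficients compensate after exchanging the two
  -- summation indices, so `f` is isometric relative to `e`.
  have hinner : ∀ c : ι →₀ ℂ, ⟪f c, f c⟫_ℂ = ⟪(e c : K), (e c : K)⟫_ℂ := fun c => by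
    rw [he]
    change ⟪c.sum fun i z => conj z • b i, c.sum fun i z => conj z • b i⟫_ℂ = _
    simp only [Finsupp.sum, sum_inner, inner_sum, inner_smul_left, inner_smul_right, h,
      Complex.conj_conj, Finset.mul_sum]
    rw [Finset.sum_comm]
    refine Finset.sum_congr rfl fun i _ => Finset.sum_congr rfl fun j _ => ?_
    ring
  have hnorm : ∀ c, ‖f c‖ ≤ 1 * ‖e c‖ := fun c => by
    rw [one_mul, ← Submodule.norm_coe (e c), norm_eq_sqrt_re_inner (𝕜 := ℂ), hinner,
      ← norm_eq_sqrt_re_inner]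
  have hdense : DenseRange e := by
    intro x
    have hx : (x : K) ∈ closure (Submodule.span ℂ (Set.range a) : Set K) := x.2
    rw [closure_subtype]
    refine closure_mono (fun y hy => ?_) hx
    obtain ⟨c, rfl⟩ := Finsupp.mem_span_range_iff_exists_finsupp.1 hy
    exact ⟨e c, ⟨c, rfl⟩, he c⟩
  -- Extension by density reaches only the closed span `M`; the orthogonal projection extends it to
  -- all of `K`.
  refine ⟨(f.extendOfNorm e).comp M.orthogonalProjectionOnto, fun i => ?_⟩
  have h1 : M.orthogonalProjectionOnto (a i) = e (Finsupp.single i 1) := by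
    rw [M.orthogonalProjectionOnto_mem_subspace_eq_self ⟨a i, hM i⟩]
    simp [e]
  rw [ContinuousLinearMap.comp_apply, h1, LinearMap.extendOfNorm_eq hdense ⟨1, hnorm⟩]
  change (Finsupp.single i 1).sum (fun i z => conj z • b i) = _
  simp

/-! ### The Hilbert space model $L^2\oplus\mathbf C$ -/

namespace SchwartzMap

variable {V : Type} [NormedAddCommGroup V] [InnerProductSpace ℝ V] [FiniteDimensional ℝ V]
  [MeasurableSpace V] [BorelSpace V]

variable (V) in
/-- The functional `F ↦ ∫ F(x, x) dx`. -/
def diagIntegral : 𝓢(V × V, ℂ) →L[ℂ] ℂ :=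
  (integralCLM ℂ (volume : Measure V)).comp
    (compCLMOfAntilipschitz (K := 1) ℂ (g := fun x : V => (x, x))
      ((ContinuousLinearMap.id ℝ V).prod (ContinuousLinearMap.id ℝ V)).hasTemperateGrowth
      (AntilipschitzWith.of_le_mul_dist fun x y => by simp [Prod.dist_eq]))

theorem diagIntegral_apply (F : 𝓢(V × V, ℂ)) : diagIntegral V F = ∫ x, F (x, x) := by
  rw [diagIntegral, ContinuousLinearMap.comp_apply, integralCLM_apply]
  rfl

variable (V) in
/-- The map `F ↦ p (F, ∫ F(x, x) dx)` into `L² ⊕ ℂ`. -/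
def noiseEmbedding (p : ℝ) : 𝓢(V × V, ℂ) →L[ℂ]
    WithLp 2 (Lp ℂ 2 ((volume : Measure V).prod (volume : Measure V)) × ℂ) :=
  (p : ℂ) • ((WithLp.prodContinuousLinearEquiv 2 ℂ _ ℂ).symm.toContinuousLinearMap.comp
    ((toLpCLM ℂ ℂ 2 ((volume : Measure V).prod volume)).prod (diagIntegral V)))

theorem inner_noiseEmbedding (p : ℝ) (F G : 𝓢(V × V, ℂ)) :
    ⟪noiseEmbedding V p F, noiseEmbedding V p G⟫_ℂ =
      p ^ 2 * ((∫ z : V × V, conj (F z) * G z) + conj (diagIntegral V F) * diagIntegral V G) := by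
  change ⟪(p : ℂ) • WithLp.toLp 2 (F.toLp 2 ((volume : Measure V).prod volume), diagIntegral V F),
    (p : ℂ) • WithLp.toLp 2 (G.toLp 2 ((volume : Measure V).prod volume), diagIntegral V G)⟫_ℂ = _
  have h : ⟪F.toLp 2 ((volume : Measure V).prod volume),
      G.toLp 2 ((volume : Measure V).prod volume)⟫_ℂ = ∫ z : V × V, conj (F z) * G z :=
    (inner_toL2_toL2_eq F G _).trans (by simp [Measure.volume_eq_prod, mul_comm])
  rw [inner_smul_left, inner_smul_right, WithLp.prod_inner_apply, h,
    Complex.conj_ofReal, ← mul_assoc, ← sq, RCLike.inner_apply, mul_comm (diagIntegral V G)]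

theorem diagIntegral_tensorConj (φ ψ : 𝓢(V, ℂ)) :
    diagIntegral V (tensorConj φ ψ) = ∫ x, φ x * conj (ψ x) := diagIntegral_apply _

theorem integral_conj_tensorConj_mul (φ ψ φ' ψ' : 𝓢(V, ℂ)) :
    ∫ z : V × V, conj (tensorConj φ ψ z) * tensorConj φ' ψ' z =
      (∫ x, φ' x * conj (φ x)) * conj (∫ x, ψ' x * conj (ψ x)) := by
  rw [← integral_conj, Measure.volume_eq_prod, ← integral_prod_mul]
  congr 1
  funext z
  change conj (φ z.1 * conj (ψ z.2)) * (φ' z.1 * conj (ψ' z.2)) = _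
  simp
  ring

end SchwartzMap

/-! ### Existence, uniqueness, mean and covariance of $u\otimes\overline u$ -/

namespace TemperedGSP

variable {V : Type} [NormedAddCommGroup V] [InnerProductSpace ℝ V] [FiniteDimensional ℝ V]
  [MeasurableSpace V] [BorelSpace V] {Ω : Type*} [MeasurableSpace Ω]
  {P : Measure Ω} [IsProbabilityMeasure P] {u : TemperedGSP V P} {p : ℝ}
  {U : TemperedGSP (V × V) P}

theorem IsWhiteNoise.cov_eq_diagIntegral (hw : u.IsWhiteNoise p) (φ ψ : 𝓢(V, ℂ)) :
    u.cov φ ψ = p * conj (diagIntegral V (tensorConj φ ψ)) := by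
  rw [hw.2.2, diagIntegral_tensorConj, ← integral_conj]
  simp [mul_comm]

/-- The pairing of $\varphi$ with $\psi$ gives the $\mathbf C$ component of the inner product; the
pairing of $\varphi$ with $\varphi'$ gives the $L^2$ component. -/
theorem fourthMoment_eq_inner_noiseEmbedding (hg : u.IsGaussian) (h0 : u.IsZeroMean)
    (hs : u.IsSymmetric) (hw : u.IsWhiteNoise p) (φ ψ φ' ψ' : 𝓢(V, ℂ)) :
    ∫ ω, u φ ω * conj (u ψ ω) * conj (u φ' ω * conj (u ψ' ω)) ∂P =
      ⟪noiseEmbedding V p (tensorConj φ ψ), noiseEmbedding V p (tensorConj φ' ψ')⟫_ℂ := by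
  rw [hg.integral_mul_conj_mul_conj h0 hs, inner_noiseEmbedding, integral_conj_tensorConj_mul,
    hw.cov_eq_diagIntegral φ, hw.cov_eq_diagIntegral φ' ψ', hw.2.2, hw.2.2]
  simp only [map_mul, Complex.conj_ofReal, Complex.conj_conj]
  ring

/-- Existence of `u ⊗ ū`. -/
theorem exists_isTensorSquare (hg : u.IsGaussian) (h0 : u.IsZeroMean)
    (hs : u.IsSymmetric) (hw : u.IsWhiteNoise p) :
    ∃ U : TemperedGSP (V × V) P, u.IsTensorSquare U := by
  have hmem : ∀ q : 𝓢(V, ℂ) × 𝓢(V, ℂ), MemLp (fun ω => u q.1 ω * conj (u q.2 ω)) 2 P :=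
    fun q => MemLp.mul_of_four (hg.memLp_four q.1) (hg.memLp_conj_four q.2)
  obtain ⟨J, hJ⟩ := exists_conjLinear_of_gram
    (fun q : 𝓢(V, ℂ) × 𝓢(V, ℂ) => noiseEmbedding V p (tensorConj q.1 q.2))
    (fun q => (hmem q).toLp) fun q q' => by
      rw [← fourthMoment_eq_inner_noiseEmbedding hg h0 hs hw, L2.inner_def]
      refine integral_congr_ae ?_
      filter_upwards [(hmem q).coeFn_toLp, (hmem q').coeFn_toLp] with ω h1 h2
      rw [h1, h2]
      rfl
  refine ⟨J.comp (noiseEmbedding V p), fun φ ψ => ?_⟩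
  rw [ContinuousLinearMap.comp_apply, hJ (φ, ψ)]
  exact (hmem (φ, ψ)).coeFn_toLp

theorem IsTensorSquare.unique {U' : TemperedGSP (V × V) P} (hU : u.IsTensorSquare U)
    (hU' : u.IsTensorSquare U') : U = U' := by
  refine ContinuousLinearMap.ext_on (dense_span_tensorConj V) ?_
  rintro _ ⟨⟨φ, ψ⟩, rfl⟩
  exact Lp.ext ((hU φ ψ).trans (hU' φ ψ).symm)

theorem IsTensorSquare.integral_eq (hU : u.IsTensorSquare U) (hw : u.IsWhiteNoise p)
    (F : 𝓢(V × V, ℂ)) : ∫ ω, U F ω ∂P = p * conj (diagIntegral V F) := by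
  have h : (expectationL2 P).comp U =
      (p : ℂ) • ((starL ℂ : ℂ ≃L⋆[ℂ] ℂ) : ℂ →L⋆[ℂ] ℂ).comp (diagIntegral V) := by
    refine ContinuousLinearMap.ext_on (dense_span_tensorConj V) ?_
    rintro _ ⟨⟨φ, ψ⟩, rfl⟩
    exact (integral_congr_ae (hU φ ψ)).trans (hw.cov_eq_diagIntegral φ ψ)
  exact DFunLike.congr_fun h F

/-- Both sides are continuous and sesquilinear, so density of tensors applies in one variable at a
time: `h1` frees `F` with a tensor in the other slot, then `h2` frees `G`. -/
theorem IsTensorSquare.cov_eq (hU : u.IsTensorSquare U) (hg : u.IsGaussian) (h0 : u.IsZeroMean)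
    (hs : u.IsSymmetric) (hw : u.IsWhiteNoise p) (F G : 𝓢(V × V, ℂ)) :
    U.cov F G = ⟪noiseEmbedding V p F, noiseEmbedding V p G⟫_ℂ := by
  have h1 : ∀ (φ' ψ' : 𝓢(V, ℂ)) (F : 𝓢(V × V, ℂ)), ⟪U (tensorConj φ' ψ'), U F⟫_ℂ =
      ⟪noiseEmbedding V p F, noiseEmbedding V p (tensorConj φ' ψ')⟫_ℂ := fun φ' ψ' F => by
    have h : (innerSL ℂ (U (tensorConj φ' ψ'))).comp U =
        (innerSLFlip ℂ (noiseEmbedding V p (tensorConj φ' ψ'))).comp (noiseEmbedding V p) := by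
      refine ContinuousLinearMap.ext_on (dense_span_tensorConj V) ?_
      rintro _ ⟨⟨φ, ψ⟩, rfl⟩
      refine Eq.trans ?_ (fourthMoment_eq_inner_noiseEmbedding hg h0 hs hw φ ψ φ' ψ')
      refine integral_congr_ae ?_
      filter_upwards [hU φ ψ, hU φ' ψ'] with ω e1 e2
      change ⟪U (tensorConj φ' ψ') ω, U (tensorConj φ ψ) ω⟫_ℂ = _
      rw [e1, e2]
      rfl
    exact DFunLike.congr_fun h F
  have h2 : (innerSLFlip ℂ (U F)).comp U =
      (innerSL ℂ (noiseEmbedding V p F)).comp (noiseEmbedding V p) := by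
    refine ContinuousLinearMap.ext_on (dense_span_tensorConj V) ?_
    rintro _ ⟨⟨φ, ψ⟩, rfl⟩
    exact h1 φ ψ F
  exact DFunLike.congr_fun h2 G

end TemperedGSP

/-! ### The operator $A$: isometry and restriction to the diagonal -/

section Wigner

theorem integrable_of_isAddHaarMeasure {W : Type} [NormedAddCommGroup W] [NormedSpace ℝ W]
    [FiniteDimensional ℝ W] [MeasurableSpace W] [BorelSpace W] (μ : Measure W) [μ.IsAddHaarMeasure]
    (F : 𝓢(W, ℂ)) : Integrable F μ := F.integrable

theorem integrable_conj_mul {W : Type} [NormedAddCommGroup W] [NormedSpace ℝ W]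
    [FiniteDimensional ℝ W] [MeasurableSpace W] [BorelSpace W] (μ : Measure W) [μ.IsAddHaarMeasure]
    (F G : 𝓢(W, ℂ)) : Integrable (fun z => conj (F z) * G z) μ :=
  memLp_one_iff_integrable.1 ((G.memLp 2 μ).mul' (F.memLp 2 μ).star)

theorem measurePreserving_kappa (d : ℕ) : MeasurePreserving (kappa d) volume volume := by
  let E := EuclideanSpace ℝ (Fin d)
  have h1 : MeasurePreserving (fun z : E × E => (z.1, z.2 + (1 / 2 : ℝ) • z.1)) volume volume :=
    (MeasurePreserving.id (volume : Measure E)).skew_product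
      (g := fun y x => x + (1 / 2 : ℝ) • y) (by fun_prop)
      (.of_forall fun y => map_add_right_eq_self _ _)
  have h2 : MeasurePreserving (fun z : E × E => (z.1, z.1 - z.2)) volume volume :=
    (MeasurePreserving.id (volume : Measure E)).skew_product
      (g := fun a y => a - y) (by fun_prop)
      (.of_forall fun a => Measure.map_sub_left_eq_self _ a)
  have h3 : MeasurePreserving (Prod.swap : E × E → E × E) volume volume :=
    Measure.measurePreserving_swap
  -- The map factors as $(x,y)\mapsto(x+y/2,\,y)$, a shear, followed by $(a,y)\mapsto(a,\,a-y)$.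
  convert! h2.comp (h3.comp (h1.comp h3)) using 1
  funext z
  refine Prod.ext rfl ?_
  change z.1 - (1 / 2 : ℝ) • z.2 = z.1 + (1 / 2 : ℝ) • z.2 - z.2
  module

theorem partialFourierInv_eq_fourier (d : ℕ)
    (Φ : 𝓢(EuclideanSpace ℝ (Fin d) × EuclideanSpace ℝ (Fin d), ℂ))
    (x y : EuclideanSpace ℝ (Fin d)) :
    partialFourierInv d Φ (x, y) = (((2 * Real.pi) ^ (-(d : ℝ) / 2) : ℝ) : ℂ) *
      FourierTransform.fourier (PartialFourier.slice Φ x) (-(2 * Real.pi)⁻¹ • y) := by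
  rw [← PartialFourier.partialIntegral_eq Φ (x, y)]
  rfl

/-- Plancherel's formula for the partial Fourier transform. -/
theorem integral_conj_partialFourierInv_mul (d : ℕ)
    (Φ Ψ : 𝓢(EuclideanSpace ℝ (Fin d) × EuclideanSpace ℝ (Fin d), ℂ)) :
    ∫ z, conj (partialFourierInv d Φ z) * partialFourierInv d Ψ z = ∫ z, conj (Φ z) * Ψ z := by
  rw [Measure.volume_eq_prod, integral_prod _ (integrable_conj_mul _ _ _),
    integral_prod _ (integrable_conj_mul _ _ _)]
  congr 1
  funext x
  set c : ℝ := (2 * Real.pi) ^ (-(d : ℝ) / 2) with hc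
  -- The squared normalization cancels the Jacobian $(2\pi)^d$ of the rescaling
  -- $y\mapsto-(2\pi)^{-1}y$.
  have hc2 : c ^ 2 * (2 * Real.pi) ^ d = 1 := by
    rw [hc, ← Real.rpow_natCast, ← Real.rpow_mul (by positivity), ← Real.rpow_natCast _ d,
      ← Real.rpow_add (by positivity)]
    norm_num
  let f := FourierTransform.fourier (PartialFourier.slice Φ x)
  let g := FourierTransform.fourier (PartialFourier.slice Ψ x)
  have h1 : ∀ y, conj (partialFourierInv d Φ (x, y)) * partialFourierInv d Ψ (x, y) =
      ((c ^ 2 : ℝ) : ℂ) * (conj (f (-(2 * Real.pi)⁻¹ • y)) * g (-(2 * Real.pi)⁻¹ • y)) :=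
    fun y => by
      rw [partialFourierInv_eq_fourier, partialFourierInv_eq_fourier, map_mul, Complex.conj_ofReal]
      push_cast
      ring
  have h2 : ∫ y, conj (f y) * g y = ∫ ξ, conj (Φ (x, ξ)) * Ψ (x, ξ) := by
    have := integral_inner_fourier_fourier (PartialFourier.slice Φ x) (PartialFourier.slice Ψ x)
    simp only [RCLike.inner_apply, mul_comm _ (conj _)] at this
    exact this
  simp_rw [h1]
  rw [integral_const_mul, Measure.integral_comp_smul volume (fun y => conj (f y) * g y), h2,
    finrank_euclideanSpace_fin, abs_inv, abs_pow, abs_neg, abs_inv,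
    abs_of_pos (by positivity : 0 < 2 * Real.pi), inv_pow, inv_inv, Complex.real_smul,
    ← mul_assoc, ← Complex.ofReal_mul, hc2, Complex.ofReal_one, one_mul]

theorem integral_conj_wignerPullback_mul (d : ℕ)
    (Φ Ψ : 𝓢(EuclideanSpace ℝ (Fin d) × EuclideanSpace ℝ (Fin d), ℂ)) :
    ∫ z, conj (wignerPullback d Φ z) * wignerPullback d Ψ z = ∫ z, conj (Φ z) * Ψ z := by
  rw [← integral_conj_partialFourierInv_mul d Φ]
  have h := (measurePreserving_kappa d).symm (kappa d).toHomeomorph.toMeasurableEquiv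
  exact h.integral_comp (kappa d).symm.toHomeomorph.measurableEmbedding
    (fun z => conj (partialFourierInv d Φ z) * partialFourierInv d Ψ z)

/-- On the diagonal the midpoint is $x$ and the difference is zero, so the exponential disappears.
-/
theorem diagIntegral_wignerPullback (d : ℕ)
    (Φ : 𝓢(EuclideanSpace ℝ (Fin d) × EuclideanSpace ℝ (Fin d), ℂ)) :
    diagIntegral _ (wignerPullback d Φ) =
      (((2 * Real.pi) ^ (-(d : ℝ) / 2) : ℝ) : ℂ) * ∫ z, Φ z := by
  rw [diagIntegral_apply, Measure.volume_eq_prod, integral_prod _ (integrable_of_isAddHaarMeasure _ Φ),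
    ← integral_const_mul]
  congr 1
  funext x
  rw [wignerPullback_apply, partialFourierInv_apply, sub_self, ← two_smul ℝ x, smul_smul]
  simp

end Wigner

/-! ### Removal of the mean and conclusion -/

namespace TemperedGSP

variable {Ω : Type*} [MeasurableSpace Ω] {P : Measure Ω} [IsProbabilityMeasure P]

theorem cov_center {V : Type} [NormedAddCommGroup V] [NormedSpace ℝ V] (U : TemperedGSP V P)
    (F G : 𝓢(V, ℂ)) :
    U.center.cov F G = U.cov F G - (∫ ω, U F ω ∂P) * conj (∫ ω, U G ω ∂P) := by
  have hF := Lp.memLp (U F)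
  have hG := Lp.memLp (U G)
  have i1 : Integrable (fun ω => U F ω * conj (U G ω)) P :=
    memLp_one_iff_integrable.1 (hG.star.mul' hF)
  have i2 := hF.integrable one_le_two
  have i3 : Integrable (fun ω => conj (U G ω)) P := (hG.star).integrable one_le_two
  have h : U.center.cov F G = ∫ ω, (U F ω - ∫ ω', U F ω' ∂P) *
      conj (U G ω - ∫ ω', U G ω' ∂P) ∂P := by
    refine integral_congr_ae ?_
    filter_upwards [centerL2_coeFn P (U F), centerL2_coeFn P (U G)] with ω h1 h2
    change centerL2 P (U F) ω * conj (centerL2 P (U G) ω) = _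
    rw [h1, h2]
  rw [h, cov]
  set a := ∫ ω, U F ω ∂P with ha
  set b := ∫ ω, U G ω ∂P with hb
  have e : ∀ ω, (U F ω - a) * conj (U G ω - b) = U F ω * conj (U G ω) -
      a * conj (U G ω) - U F ω * conj b + a * conj b := fun ω => by
    rw [map_sub]; ring
  simp_rw [e]
  rw [integral_add (by fun_prop) (by fun_prop), integral_sub (by fun_prop) (by fun_prop),
    integral_sub (by fun_prop) (by fun_prop), integral_const_mul, integral_mul_const,
    integral_conj, ← ha, ← hb]
  simp

end TemperedGSP

theorem corollary6p5 {Ω : Type*} [MeasurableSpace Ω] (P : Measure Ω) [IsProbabilityMeasure P]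
    (d : ℕ) (u : TemperedGSP (EuclideanSpace ℝ (Fin d)) P) (p : ℝ)
    (hu_mean : u.IsZeroMean) (hu_gauss : u.IsGaussian) (hu_symm : u.IsSymmetric)
    (hu_white : u.IsWhiteNoise p) :
    (∃! U : TemperedGSP (EuclideanSpace ℝ (Fin d) × EuclideanSpace ℝ (Fin d)) P,
      u.IsTensorSquare U) ∧
    ∀ U : TemperedGSP (EuclideanSpace ℝ (Fin d) × EuclideanSpace ℝ (Fin d)) P,
      u.IsTensorSquare U →
        U.wigner.HasConstantMean (((2 * Real.pi) ^ (-(d : ℝ) / 2) * p : ℝ) : ℂ) ∧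
        U.center.wigner.IsZeroMean ∧
        U.center.wigner.IsWhiteNoise (p ^ 2) := by
  refine ⟨?_, fun U hU => ?_⟩
  · obtain ⟨U, hU⟩ := TemperedGSP.exists_isTensorSquare hu_gauss hu_mean hu_symm hu_white
    exact ⟨U, hU, fun U' hU' => hU'.unique hU⟩
  have hmean : U.center.wigner.IsZeroMean := fun Φ => by
    change ∫ ω, centerL2 P (U (wignerPullback d Φ)) ω ∂P = 0
    rw [integral_congr_ae (centerL2_coeFn P _), integral_sub
      ((Lp.memLp _).integrable one_le_two) (integrable_const _)]
    simp
  have hcov : ∀ Φ Ψ, U.center.wigner.cov Φ Ψ = (p ^ 2 : ℝ) * ∫ z, Ψ z * conj (Φ z) :=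
    fun Φ Ψ => by
      change U.center.cov (wignerPullback d Φ) (wignerPullback d Ψ) = _
      -- The product of the means is $p^2\,\overline{\delta(A\Phi)}\,\delta(A\Psi)$, which cancels
      -- the $\mathbf C$ component of the covariance of `U`.
      rw [TemperedGSP.cov_center, hU.cov_eq hu_gauss hu_mean hu_symm hu_white,
        hU.integral_eq hu_white, hU.integral_eq hu_white, inner_noiseEmbedding,
        integral_conj_wignerPullback_mul]
      simp only [map_mul, Complex.conj_conj, Complex.conj_ofReal, mul_comm (conj (Φ _))]
      push_cast
      ring
  refine ⟨fun Φ => ?_, hmean, pow_pos hu_white.1 2, ⟨⟨0, fun Φ => ?_⟩, fun a Φ Ψ => ?_⟩, hcov⟩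
  · change ∫ ω, U (wignerPullback d Φ) ω ∂P = _
    rw [hU.integral_eq hu_white, diagIntegral_wignerPullback, integral_const_mul, integral_conj,
      map_mul, Complex.conj_ofReal]
    push_cast
    ring
  · rw [hmean Φ]
    simp
  -- Translation invariance of the covariance follows from its explicit form and the invariance of
  -- Lebesgue measure.
  · rw [hcov, hcov]
    congr 1
    exact integral_sub_right_eq_self (μ := (volume : Measure (EuclideanSpace ℝ (Fin d))).prod volume)
      (fun z => Ψ z * conj (Φ z)) a

end
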